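/- Let $K$ be a number field with ring of integers $\mathcal O_K$. A rigid adelic space (equivalently, a Hermitian vector bundle) over $K$ is a finite-dimensional $K$-vector space $E$ together with a finitely generated $\mathcal O_K$-submodule $L\subset E$ spanning $E$ over $K$ and, for every Archimedean place $v$ of $K$, a positive definite form $h_v$ on $E_v=E\otimes_K K_v$, symmetric if $v$ is real and Hermitian if $v$ is complex. Writing $L=\bigoplus_{i=1}^{n}\mathfrak a_i b_i$ with fractional ideals $\mathfrak a_i$ and a $K$-basis $(b_i)$ of $E$, its height is $$H(E)=\Bigl(\mathrm N\bigl(\textstyle\prod_i\mathfrak a_i\bigr)\prod_{v\mid\infty}\det\bigl(h_v(b_i,b_j)\bigr)^{e_v/2}\Bigr)^{1/[K:\mathbb Q]},$$ where $e_v=1$ or $2$ according to whether $v$ is real or complex; this does not depend on the choice of the $\mathfrak a_i$ and $b_i$. For $E\neq0$ put $H_r(E)=H(E)^{1/\dim E}$. A subspace $W\subset E$ is a rigid adelic space with lattice $L\cap W$ and the restricted forms, and $$H_{\min}(E)=\min_{0\neq W\subset E}H_r(W).$$ (If $E=0$, when there is no such $W$, put $H_{\min}(E)=0$.) A nonzero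 $E$ is stable if $H_r(W)>H_r(E)$ for every subspace $0\subsetneq W\subsetneq E$. The tensor product of $(E,L,(h_v))$ and $(F,M,(h'_v))$ is $E\otimes_K F$ with the lattice generated by the $x\otimes y$ $(x\in L,\ y\in M)$ and the forms $h_v\otimes h'_v$. **Corollary 2.6.** Let $F$ be a rigid adelic space of rank $2$ over a number field $K$ which is not stable. Then for every rigid adelic space $E$ over $K$, $$H_{\min}(E\otimes F)=H_{\min}(E)\,H_{\min}(F).$$ -/

import Mathlib

open NumberField Module
open scoped TensorProduct nonZeroDivisors ComplexOrder

noncomputable section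

variable {K : Type*} [Field K]

/-- The forms `E × E → ℂ` that are additive in both variables and satisfy
`h (a x) (c y) = conj (σ a) * h x y * σ c`, where `σ : K → ℂ` is the embedding attached to the
infinite place `v`. Such forms are the restrictions to `E` of the sesquilinear forms
(antilinear in the first variable) on `E ⊗_{K, σ} ℂ`; each form extends uniquely. -/
abbrev SesqForm (v : InfinitePlace K) (E : Type*) [AddCommGroup E] [Module K E] :=
  E →ₛₗ[(starRingEnd ℂ).comp v.embedding] E →ₛₗ[v.embedding] ℂ

/-- The Gram matrix `(h (b i) (b j))` of a family of vectors. -/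
def SesqForm.gram {v : InfinitePlace K} {E : Type*} [AddCommGroup E] [Module K E]
    (h : SesqForm v E) {ι : Type*} (b : ι → E) : Matrix ι ι ℂ :=
  Matrix.of fun i j => h (b i) (b j)

/-- A rigid adelic space over the number field `K` with underlying `K`-vector space `E`
(equivalently, a Hermitian vector bundle over `Spec 𝓞 K`):
a finitely generated `𝓞 K`-submodule of `E` spanning `E` over `K`, and for every infinite place
`v` a positive definite form on `E ⊗ K_v`, symmetric if `v` is real (so with real values on `E`)
and Hermitian if `v` is complex. The form on `E ⊗ K_v` is given by its restriction to `E`; since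
a `K`-basis of `E` is a `K_v`-basis of `E ⊗ K_v`, the form on `E ⊗ K_v` is positive definite
exactly when its Gram matrix in a `K`-basis of `E` is. At a complex place one of the two
conjugate embeddings is used; the form for the other one is the complex conjugate. -/
structure RigidAdelicSpace (K : Type*) [Field K] [NumberField K]
    (E : Type*) [AddCommGroup E] [Module K E] [Module (𝓞 K) E] [IsScalarTower (𝓞 K) K E] where
  /-- the `𝓞 K`-lattice giving the norms at the finite places -/
  lattice : Submodule (𝓞 K) E
  isLattice : lattice.IsLattice K
  /-- the Hermitian forms at the infinite places -/
  form : ∀ v : InfinitePlace K, SesqForm v E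
  conj_symm : ∀ v x y, starRingEnd ℂ (form v x y) = form v y x
  real_of_isReal : ∀ v : InfinitePlace K, v.IsReal → ∀ x y, (form v x y).im = 0
  posDef : ∀ (v : InfinitePlace K) (n : ℕ) (b : Basis (Fin n) K E), ((form v).gram b).PosDef

section gram

variable {E : Type*} [AddCommGroup E] [Module K E] {v : InfinitePlace K} (h : SesqForm v E)

/-- Change of Gram matrix: if `c j = ∑ i, A i j • b i` then `Gram(c) = σ(A)ᴴ Gram(b) σ(A)`. -/
theorem SesqForm.gram_change {ι κ : Type*} [Fintype ι] (b : ι → E) (c : κ → E)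
    (A : Matrix ι κ K) (hA : ∀ j, c j = ∑ i, A i j • b i) :
    h.gram c = (A.map v.embedding).conjTranspose * h.gram b * A.map v.embedding := by
  ext j k
  rw [SesqForm.gram, Matrix.of_apply, hA j, hA k]
  simp only [map_sum, LinearMap.sum_apply, LinearMap.map_smulₛₗ, LinearMap.smul_apply,
    Matrix.mul_apply, Matrix.conjTranspose_apply, Matrix.map_apply, SesqForm.gram,
    Matrix.of_apply, smul_eq_mul, RingHom.comp_apply, Finset.sum_mul, Finset.mul_sum,
    starRingEnd_apply]
  refine Finset.sum_congr rfl fun i _ => Finset.sum_congr rfl fun l _ => ?_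
  ring

/-- Positive definiteness passes from one basis to every linearly independent family. -/
theorem SesqForm.gram_posDef {ι κ : Type*} [Fintype ι] [Fintype κ] (b : Basis ι K E)
    (hb : (h.gram b).PosDef) (c : κ → E) (hc : LinearIndependent K c) :
    (h.gram c).PosDef := by
  classical
  rw [h.gram_change b c (Matrix.of fun i j => b.repr (c j) i)
    (fun j => by simp)]
  refine hb.conjTranspose_mul_mul_same ?_
  -- a left inverse of the coordinate matrix over `K` stays one over `ℂ`
  obtain ⟨g, hg⟩ := (Finsupp.linearCombination K c).exists_leftInverse_of_injective
    (LinearMap.ker_eq_bot.mpr hc)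
  let B : Matrix κ ι K := Matrix.of fun j i => g (b i) j
  have hBA : B * (Matrix.of fun i j => b.repr (c j) i) = 1 := by
    ext j k
    have h1 : g (c k) = Finsupp.single k 1 := by
      have := LinearMap.congr_fun hg (Finsupp.single k 1)
      simpa using this
    have h2 := congrArg (fun f => f j) (congrArg g (b.sum_repr (c k)))
    simp only [map_sum, map_smul, Finsupp.coe_finsetSum, Finset.sum_apply, Finsupp.smul_apply,
      smul_eq_mul, h1] at h2
    rw [Matrix.mul_apply, Matrix.one_apply]
    simp only [B, Matrix.of_apply]
    rw [Finsupp.single_apply] at h2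
    simp only [eq_comm (a := k)] at h2
    rw [← h2]
    exact Finset.sum_congr rfl fun i _ => mul_comm _ _
  have hmap : B.map v.embedding * (Matrix.of fun i j => b.repr (c j) i).map v.embedding = 1 := by
    rw [← Matrix.map_mul, hBA]
    simp
  intro x y hxy
  have := congrArg ((B.map v.embedding).mulVec) hxy
  simpa only [Matrix.mulVec_mulVec, hmap, Matrix.one_mulVec] using this

variable {F : Type*} [AddCommGroup F] [Module K F]

/-- The tensor product of two forms,
`(h ⊗ h') (x ⊗ y) (x' ⊗ y') = h x x' * h' y y'`. -/
def tensorForm {v : InfinitePlace K} (h : SesqForm v E) (h' : SesqForm v F) :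
    SesqForm v (E ⊗[K] F) :=
  TensorProduct.lift <| LinearMap.mk₂'ₛₗ _ _
    (fun x y => TensorProduct.lift <| LinearMap.mk₂'ₛₗ v.embedding v.embedding
      (fun x' y' => h x x' * h' y y')
      (by intros; simp [add_mul]) (by intros; simp [mul_assoc])
      (by intros; simp [mul_add]) (by intros; simp; ring))
    (by intros; ext; simp [add_mul]) (by intros; ext; simp; ring)
    (by intros; ext; simp [mul_add]) (by intros; ext; simp; ring)

@[simp] theorem tensorForm_tmul {v : InfinitePlace K} (h : SesqForm v E) (h' : SesqForm v F)
    (x x' : E) (y y' : F) :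
    tensorForm h h' (x ⊗ₜ y) (x' ⊗ₜ y') = h x x' * h' y y' := by
  simp [tensorForm]

end gram

namespace RigidAdelicSpace

variable [NumberField K]
variable {E : Type*} [AddCommGroup E] [Module K E] [Module (𝓞 K) E] [IsScalarTower (𝓞 K) K E]
variable {F : Type*} [AddCommGroup F] [Module K F] [Module (𝓞 K) F] [IsScalarTower (𝓞 K) K F]

theorem finiteDimensional (X : RigidAdelicSpace K E) : Module.Finite K E := by
  obtain ⟨s, hs⟩ := X.isLattice.fg
  refine ⟨s, ?_⟩
  have h := X.isLattice.span_eq_top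
  rw [← hs, Submodule.span_span_of_tower] at h
  exact h

/-- Every vector of `E` has a nonzero integral multiple in the lattice. -/
theorem exists_smul_mem (X : RigidAdelicSpace K E) (x : E) :
    ∃ d : 𝓞 K, d ≠ 0 ∧ d • x ∈ X.lattice := by
  have hx : x ∈ Submodule.span K (X.lattice : Set E) := by
    rw [X.isLattice.span_eq_top]; trivial
  induction hx using Submodule.span_induction with
  | mem x h => exact ⟨1, one_ne_zero, by simpa using h⟩
  | zero => exact ⟨1, one_ne_zero, by simp⟩
  | add x y _ _ hx hy =>
    obtain ⟨d, hd, hdx⟩ := hx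
    obtain ⟨e, he, hey⟩ := hy
    refine ⟨d * e, mul_ne_zero hd he, ?_⟩
    rw [smul_add]
    refine add_mem ?_ ?_
    · rw [mul_comm, mul_smul]; exact X.lattice.smul_mem _ hdx
    · rw [mul_smul]; exact X.lattice.smul_mem _ hey
  | smul a x _ hx =>
    obtain ⟨d, hd, hdx⟩ := hx
    obtain ⟨p, q, hq, rfl⟩ := IsFractionRing.div_surjective (A := 𝓞 K) a
    have hq0 : q ≠ 0 := nonZeroDivisors.ne_zero hq
    have hq' : (algebraMap (𝓞 K) K q) ≠ 0 := by simpa using hq0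
    refine ⟨q * d, mul_ne_zero hq0 hd, ?_⟩
    have : (q * d) • (algebraMap (𝓞 K) K p / algebraMap (𝓞 K) K q) • x = p • d • x := by
      simp only [← IsScalarTower.algebraMap_smul K (_ : 𝓞 K) (_ : E), smul_smul, map_mul]
      congr 1
      field_simp
    rw [this]
    exact X.lattice.smul_mem _ hdx

/-- The structure induced on a subspace `W`: the lattice is `L ∩ W`, the forms are restricted. -/
def restrict (X : RigidAdelicSpace K E) (W : Submodule K E) : RigidAdelicSpace K W where
  lattice := X.lattice.comap (W.subtype.restrictScalars (𝓞 K))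
  isLattice :=
    { fg := by
        have : IsNoetherian (𝓞 K) X.lattice :=
          isNoetherian_of_fg_of_noetherian _ X.isLattice.fg
        have h1 : ((X.lattice.comap (W.subtype.restrictScalars (𝓞 K))).map
            (W.subtype.restrictScalars (𝓞 K))).FG :=
          Submodule.FG.of_le X.isLattice.fg (Submodule.map_comap_le _ _)
        exact Submodule.fg_of_fg_map_injective _ Subtype.val_injective h1
      span_eq_top := by
        rw [eq_top_iff]
        rintro x -
        obtain ⟨d, hd, hdx⟩ := X.exists_smul_mem (x : E)
        have hd' : (algebraMap (𝓞 K) K d) ≠ 0 := by simpa using hd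
        have h1 : d • x ∈ Submodule.span K
            (X.lattice.comap (W.subtype.restrictScalars (𝓞 K)) : Set W) :=
          Submodule.subset_span hdx
        have h2 := Submodule.smul_mem _ (algebraMap (𝓞 K) K d)⁻¹ h1
        rwa [← IsScalarTower.algebraMap_smul K d x, smul_smul, inv_mul_cancel₀ hd', one_smul]
          at h2 }
  form v := (X.form v).domRestrict₁₂ W W
  conj_symm v x y := X.conj_symm v x y
  real_of_isReal v hv x y := X.real_of_isReal v hv x y
  posDef v n b := by
    have := X.finiteDimensional
    exact (X.form v).gram_posDef (finBasis K E) (X.posDef v _ _) (fun i => (b i : E))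
      (b.linearIndependent.map' W.subtype (Submodule.ker_subtype W))

/-- The tensor product of rigid adelic spaces: the lattice is the image of `L ⊗ M` in `E ⊗ F`,
the form at each infinite place is the tensor product of the forms. -/
def tensor (X : RigidAdelicSpace K E) (Y : RigidAdelicSpace K F) :
    RigidAdelicSpace K (E ⊗[K] F) where
  lattice := Submodule.span (𝓞 K) {z | ∃ x ∈ X.lattice, ∃ y ∈ Y.lattice, z = x ⊗ₜ[K] y}
  isLattice :=
    { fg := by
        let f : E →ₗ[𝓞 K] F →ₗ[𝓞 K] E ⊗[K] F := LinearMap.mk₂ (𝓞 K) (fun x y => x ⊗ₜ[K] y)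
          (fun _ _ _ => TensorProduct.add_tmul _ _ _) (fun _ _ _ => rfl)
          (fun _ _ _ => TensorProduct.tmul_add _ _ _)
          (fun a x y => by
            rw [← IsScalarTower.algebraMap_smul K a y, TensorProduct.tmul_smul,
              IsScalarTower.algebraMap_smul])
        have h := Submodule.FG.map₂ f X.isLattice.fg Y.isLattice.fg
        rw [Submodule.map₂_eq_span_image2] at h
        have hs : Set.image2 (fun m n => f m n) (X.lattice : Set E) (Y.lattice : Set F) =
            {z | ∃ x ∈ X.lattice, ∃ y ∈ Y.lattice, z = x ⊗ₜ[K] y} := by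
          ext z
          constructor
          · rintro ⟨x, hx, y, hy, rfl⟩
            exact ⟨x, hx, y, hy, rfl⟩
          · rintro ⟨x, hx, y, hy, rfl⟩
            exact ⟨x, hx, y, hy, rfl⟩
        rw [hs] at h
        exact h
      span_eq_top := by
        rw [Submodule.span_span_of_tower, eq_top_iff]
        rintro z -
        induction z using TensorProduct.induction_on with
        | zero => exact zero_mem _
        | add z w hz hw => exact add_mem hz hw
        | tmul x y =>
          obtain ⟨d, hd, hdx⟩ := X.exists_smul_mem x
          obtain ⟨e, he, hey⟩ := Y.exists_smul_mem y
          have hd' : (algebraMap (𝓞 K) K d) ≠ 0 := by simpa using hd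
          have he' : (algebraMap (𝓞 K) K e) ≠ 0 := by simpa using he
          have h1 : (d • x) ⊗ₜ[K] (e • y) ∈ Submodule.span K
              {z : E ⊗[K] F | ∃ x ∈ X.lattice, ∃ y ∈ Y.lattice, z = x ⊗ₜ[K] y} :=
            Submodule.subset_span ⟨_, hdx, _, hey, rfl⟩
          have h2 := Submodule.smul_mem _
            ((algebraMap (𝓞 K) K d)⁻¹ * (algebraMap (𝓞 K) K e)⁻¹) h1
          convert h2 using 1
          rw [← IsScalarTower.algebraMap_smul K d x, ← IsScalarTower.algebraMap_smul K e y,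
            TensorProduct.tmul_smul, ← TensorProduct.smul_tmul', smul_smul, smul_smul]
          have : (algebraMap (𝓞 K) K d)⁻¹ * (algebraMap (𝓞 K) K e)⁻¹ *
              (algebraMap (𝓞 K) K e * algebraMap (𝓞 K) K d) = 1 := by field_simp
          rw [← mul_assoc] at this
          rw [this, one_smul] }
  form v := tensorForm (X.form v) (Y.form v)
  conj_symm v z w := by
    induction z using TensorProduct.induction_on with
    | zero => simp
    | add z₁ z₂ h₁ h₂ => simp [h₁, h₂]
    | tmul x y =>
      induction w using TensorProduct.induction_on with
      | zero => simp
      | add w₁ w₂ h₁ h₂ => simp [h₁, h₂]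
      | tmul x' y' => simp [X.conj_symm, Y.conj_symm]
  real_of_isReal v hv z w := by
    induction z using TensorProduct.induction_on with
    | zero => simp
    | add z₁ z₂ h₁ h₂ => simp [h₁, h₂]
    | tmul x y =>
      induction w using TensorProduct.induction_on with
      | zero => simp
      | add w₁ w₂ h₁ h₂ => simp [h₁, h₂]
      | tmul x' y' => simp [X.real_of_isReal v hv, Y.real_of_isReal v hv]
  posDef v n b := by
    have := X.finiteDimensional
    have := Y.finiteDimensional
    refine (tensorForm (X.form v) (Y.form v)).gram_posDef
      ((finBasis K E).tensorProduct (finBasis K F)) ?_ b b.linearIndependent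
    have h := (X.posDef v _ (finBasis K E)).kronecker (Y.posDef v _ (finBasis K F))
    have hg : (tensorForm (X.form v) (Y.form v)).gram
        ((finBasis K E).tensorProduct (finBasis K F)) =
        Matrix.kroneckerMap (· * ·) ((X.form v).gram (finBasis K E))
          ((Y.form v).gram (finBasis K F)) := by
      ext ⟨i, j⟩ ⟨k, l⟩
      simp [SesqForm.gram]
    rw [hg]
    exact h

theorem isFractional_det (X : RigidAdelicSpace K E) {ι : Type*} [Fintype ι] [DecidableEq ι]
    (b : Basis ι K E) : IsFractional (𝓞 K)⁰
      (Submodule.span (𝓞 K) {d | ∃ l : ι → E, (∀ i, l i ∈ X.lattice) ∧ d = b.det l}) := by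
  have hcoord : ∀ i, IsFractional (𝓞 K)⁰ (X.lattice.map ((b.coord i).restrictScalars (𝓞 K))) :=
    fun i => FractionalIdeal.isFractional_of_fg (X.isLattice.fg.map _)
  choose a ha hint using hcoord
  refine ⟨∏ i, a i, prod_mem fun i _ => ha i, fun d hd => ?_⟩
  induction hd using Submodule.span_induction with
  | zero => simpa using IsLocalization.isInteger_zero
  | add x y _ _ hx hy => rw [smul_add]; exact IsLocalization.isInteger_add hx hy
  | smul r x _ hx => rw [smul_comm]; exact IsLocalization.isInteger_smul hx
  | mem d hd =>
    obtain ⟨l, hl, rfl⟩ := hd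
    have h1 : ∀ i j, ∃ m : 𝓞 K,
        algebraMap (𝓞 K) K m = algebraMap (𝓞 K) K (a i) * b.repr (l j) i := by
      intro i j
      obtain ⟨m, hm⟩ := hint i _ (Submodule.mem_map_of_mem (hl j))
      exact ⟨m, by rw [hm, Algebra.smul_def]; rfl⟩
    choose m hm using h1
    refine ⟨(Matrix.of m).det, ?_⟩
    rw [RingHom.map_det, Algebra.smul_def, map_prod, Basis.det_apply, ← Matrix.det_mul_column]
    congr 1
    ext i j
    simp [hm, Basis.toMatrix_apply]

/-- For a basis `b` of `E`, the fractional ideal generated by the determinants, in the basis `b`,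
of families of vectors of the lattice. If the lattice is `⨁ 𝔞 i • b i`, it is `∏ 𝔞 i`. -/
def detIdeal (X : RigidAdelicSpace K E) {ι : Type*} [Fintype ι] [DecidableEq ι]
    (b : Basis ι K E) : FractionalIdeal (𝓞 K)⁰ K :=
  ⟨Submodule.span (𝓞 K) {d | ∃ l : ι → E, (∀ i, l i ∈ X.lattice) ∧ d = b.det l},
    X.isFractional_det b⟩

/-- The height computed in a basis `b` of `E`; it does not depend on `b`. -/
def heightIn (X : RigidAdelicSpace K E) {ι : Type*} [Fintype ι] [DecidableEq ι]
    (b : Basis ι K E) : ℝ :=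
  (((FractionalIdeal.absNorm (X.detIdeal b) : ℚ) : ℝ) *
    ∏ v : InfinitePlace K, ((X.form v).gram b).det.re ^ ((v.mult : ℝ) / 2)) ^
      (1 / (finrank ℚ K : ℝ))

/-- The normalized height `H(E)`. -/
def height (X : RigidAdelicSpace K E) : ℝ :=
  haveI := X.finiteDimensional
  X.heightIn (finBasis K E)

theorem detIdeal_change (X : RigidAdelicSpace K E) {ι : Type*} [Fintype ι] [DecidableEq ι]
    (b c : Basis ι K E) :
    X.detIdeal c = FractionalIdeal.spanSingleton _ (c.det b) * X.detIdeal b := by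
  have hdet : ∀ l, c.det l = c.det b * b.det l := fun l => by
    conv_lhs => rw [AlternatingMap.eq_smul_basis_det b c.det]
    simp
  apply FractionalIdeal.coeToSubmodule_injective
  beta_reduce
  rw [FractionalIdeal.coe_mul, FractionalIdeal.coe_spanSingleton]
  change Submodule.span _ _ = _ * Submodule.span _ _
  rw [Submodule.span_mul_span]
  congr 1
  ext d
  simp only [Set.singleton_mul, Set.mem_image, Set.mem_ofPred_eq]
  constructor
  · rintro ⟨l, hl, rfl⟩
    exact ⟨_, ⟨l, hl, rfl⟩, (hdet l).symm⟩
  · rintro ⟨_, ⟨l, hl, rfl⟩, rfl⟩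
    exact ⟨l, hl, (hdet l).symm⟩

theorem gram_det_pos (X : RigidAdelicSpace K E) {ι : Type*} [Fintype ι] [DecidableEq ι]
    (v : InfinitePlace K) (b : Basis ι K E) : 0 < ((X.form v).gram b).det.re := by
  have := X.finiteDimensional
  have h := ((X.form v).gram_posDef (finBasis K E) (X.posDef v _ _) b b.linearIndependent).det_pos
  exact (Complex.lt_def.mp h).1

theorem heightIn_eq_of_same (X : RigidAdelicSpace K E) {ι : Type*} [Fintype ι] [DecidableEq ι]
    (b c : Basis ι K E) : X.heightIn b = X.heightIn c := by
  have hgram : ∀ v : InfinitePlace K, ((X.form v).gram b).det.re ^ ((v.mult : ℝ) / 2) =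
      v (c.det b) ^ v.mult * ((X.form v).gram c).det.re ^ ((v.mult : ℝ) / 2) := by
    intro v
    have h1 := (X.form v).gram_change c b (c.toMatrix b)
      (fun j => by simp [Basis.toMatrix_apply])
    have h2 : ((X.form v).gram b).det.re = v (c.det b) ^ 2 * ((X.form v).gram c).det.re := by
      have h3 : ((c.toMatrix b).map v.embedding).det = v.embedding (c.det b) := by
        rw [Basis.det_apply, RingHom.map_det]; rfl
      rw [h1, Matrix.det_mul, Matrix.det_mul, Matrix.det_conjTranspose, h3,
        mul_right_comm, ← starRingEnd_apply, mul_comm ((starRingEnd ℂ) _), Complex.mul_conj,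
        Complex.re_ofReal_mul, Complex.normSq_eq_norm_sq, InfinitePlace.norm_embedding_eq]
    rw [h2, Real.mul_rpow (sq_nonneg _) (X.gram_det_pos v c).le]
    congr 1
    rw [← Real.rpow_natCast, ← Real.rpow_mul (apply_nonneg _ _), ← Real.rpow_natCast]
    congr 1
    push_cast
    ring
  unfold heightIn
  rw [X.detIdeal_change b c, map_mul, FractionalIdeal.absNorm_span_singleton,
    Finset.prod_congr rfl fun v _ => hgram v, Finset.prod_mul_distrib,
    InfinitePlace.prod_eq_abs_norm]
  congr 1
  push_cast
  ring

theorem heightIn_eq (X : RigidAdelicSpace K E) {ι κ : Type*} [Fintype ι] [DecidableEq ι]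
    [Fintype κ] [DecidableEq κ] (b : Basis ι K E) (c : Basis κ K E) :
    X.heightIn b = X.heightIn c := by
  let e : ι ≃ κ := b.indexEquiv c
  rw [X.heightIn_eq_of_same b (c.reindex e.symm)]
  unfold heightIn
  congr 2
  · congr 3
    apply Subtype.ext
    change Submodule.span _ _ = Submodule.span _ _
    congr 1
    ext d
    constructor
    · rintro ⟨l, hl, rfl⟩
      exact ⟨l ∘ e.symm, fun i => hl _, by simp [Basis.det_reindex]⟩
    · rintro ⟨l, hl, rfl⟩
      exact ⟨l ∘ e, fun i => hl _, by simp [Basis.det_reindex, Function.comp_assoc]⟩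
  · refine Finset.prod_congr rfl fun v _ => ?_
    have : (X.form v).gram (c.reindex e.symm) = ((X.form v).gram c).submatrix e e := by
      ext i j; simp [SesqForm.gram]
    rw [this, Matrix.det_submatrix_equiv_self]

/-- The classical formula for the height: if the lattice is `⨁ 𝔞 i • b i` for a `K`-basis `b`
and fractional ideals `𝔞 i`, then
`H(E) = (N(∏ 𝔞 i) * ∏ v, det (h_v (b i, b j)) ^ (e_v / 2)) ^ (1 / [K : ℚ])`. -/
theorem height_eq_of_pseudoBasis (X : RigidAdelicSpace K E) {ι : Type*} [Fintype ι]
    [DecidableEq ι] (b : Basis ι K E) (𝔞 : ι → FractionalIdeal (𝓞 K)⁰ K)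
    (hL : ∀ x, x ∈ X.lattice ↔ ∀ i, b.repr x i ∈ 𝔞 i) :
    X.height = (((FractionalIdeal.absNorm (∏ i, 𝔞 i) : ℚ) : ℝ) *
      ∏ v : InfinitePlace K, ((X.form v).gram b).det.re ^ ((v.mult : ℝ) / 2)) ^
        (1 / (finrank ℚ K : ℝ)) := by
  rw [height, X.heightIn_eq _ b, heightIn]
  congr 4
  apply FractionalIdeal.coeToSubmodule_injective
  change Submodule.span _ _ = FractionalIdeal.coeSubmoduleHom _ _ _
  rw [map_prod]
  change _ = ∏ i, (𝔞 i : Submodule (𝓞 K) K)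
  apply le_antisymm
  · rw [Submodule.span_le]
    rintro _ ⟨l, hl, rfl⟩
    rw [Basis.det_apply, ← Matrix.det_transpose, Matrix.det_apply]
    refine Submodule.sum_mem _ fun τ _ => ?_
    rw [Units.smul_def]
    refine zsmul_mem ?_ _
    change ∏ i, b.toMatrix l i (τ i) ∈ _
    have h : ∀ s : Finset ι, ∏ i ∈ s, b.toMatrix l i (τ i) ∈
        ∏ i ∈ s, (𝔞 i : Submodule (𝓞 K) K) := by
      intro s
      induction s using Finset.induction_on with
      | empty => simp
      | insert j s hj ih =>
        rw [Finset.prod_insert hj, Finset.prod_insert hj]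
        exact Submodule.mul_mem_mul ((hL _).mp (hl (τ j)) j) ih
    exact h _
  · rw [Finset.prod_congr rfl fun i _ => (Submodule.span_eq (𝔞 i : Submodule (𝓞 K) K)).symm,
      Submodule.prod_span]
    refine Submodule.span_mono ?_
    intro x hx
    rw [Set.mem_finsetProd] at hx
    obtain ⟨g, hg, rfl⟩ := hx
    refine ⟨fun i => g i • b i, fun i => (hL _).mpr fun j => ?_, ?_⟩
    · by_cases hij : i = j
      · subst hij; simpa using hg (Finset.mem_univ i)
      · simpa [Finsupp.single_apply, hij] using (𝔞 j).zero_mem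
    · rw [AlternatingMap.map_smul_univ, Basis.det_self]
      simp

/-- The reduced height `H_r(E) = H(E) ^ (1 / dim E)`, used only for `E ≠ 0`. -/
def reducedHeight (X : RigidAdelicSpace K E) : ℝ :=
  X.height ^ (1 / (finrank K E : ℝ))

/-- `H_min(E)`, the minimum of the reduced heights of the nonzero subspaces of `E`, written as an
infimum of a set of nonnegative numbers, so that it is defined without knowing that it is attained
(for `E = 0` the set is empty and the value is `0`). -/
def minHeight (X : RigidAdelicSpace K E) : ℝ :=
  sInf {r | ∃ W : Submodule K E, W ≠ ⊥ ∧ r = (X.restrict W).reducedHeight}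

/-- `E` is stable if `H_r(W) > H_r(E)` for every subspace `0 ≠ W ≠ E`. -/
def IsStable (X : RigidAdelicSpace K E) : Prop :=
  ∀ W : Submodule K E, W ≠ ⊥ → W ≠ ⊤ → X.reducedHeight < (X.restrict W).reducedHeight

end RigidAdelicSpace

end

/-! Since `F` has rank 2 and is not stable, it contains a line `D = K d` with `H(D) ≤ H_r(F)`. As
`H(F) = H(D) H(F/D)` and `H(F) = H_r(F)^2`, this means `H(D) ≤ H(F/D)`. Let `W` be a nonzero
subspace of `E ⊗ F`. Then `W ∩ (E ⊗ D) = U ⊗ D`, and the image of `W` in `E ⊗ F/D` is `V ⊗ F/D`, for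
subspaces `U`, `V` of `E` of dimensions `p`, `q`. Passing to the quotient does not increase norms,
so `H(W) ≥ H(U) H(D)^p H(V) H(F/D)^q`. Here `H(U) ≥ H_min(E)^p`, `H(V) ≥ H_min(E)^q` and `H(F/D) ≥
H(D) ≥ H_min(F)`, hence `H(W) ≥ (H_min(E) H_min(F))^(p+q)`. The opposite inequality holds for all
`E` and `F`: test on the subspaces `V ⊗ V'`.

The exact sequence of lattices is handled with pseudo-bases (`IsPseudoBasis.exists_extension`), the
norms at infinity with an inequality of Gram determinants (`SesqForm.det_gram_mul_le`).
`minHeight_pow_le` brings in `H_min`, and `minHeight_mul_minHeight_le` assembles the lower bound. -/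

namespace Matrix

/-! ### Determinant inequalities for positive matrices. -/

variable {m n : Type*} [Fintype m] [Fintype n] [DecidableEq m] [DecidableEq n]

theorem PosSemidef.one_le_det_one_add {T : Matrix n n ℂ} (hT : T.PosSemidef) :
    1 ≤ (1 + T).det := by
  have hM : (1 + T).IsHermitian := isHermitian_one.add hT.1
  rw [hM.det_eq_prod_eigenvalues]
  -- An eigenvalue is the Rayleigh quotient at a unit eigenvector, here `1` plus a nonnegative
  -- number.
  have h : ∀ i, 1 ≤ hM.eigenvalues i := by
    intro i
    rw [hM.eigenvalues_eq, add_mulVec, dotProduct_add, map_add, one_mulVec]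
    have h1 : star (hM.eigenvectorBasis i).ofLp ⬝ᵥ (hM.eigenvectorBasis i).ofLp = 1 := by
      have := hM.eigenvectorBasis.orthonormal.1 i
      rw [dotProduct_comm, ← EuclideanSpace.inner_eq_star_dotProduct, inner_self_eq_norm_sq_to_K,
        this]
      simp
    rw [h1]
    have h2 := hT.re_dotProduct_nonneg (hM.eigenvectorBasis i).ofLp
    simpa using h2
  have h3 : (1 : ℝ) ≤ ∏ i, hM.eigenvalues i := Finset.one_le_prod fun i _ => h i
  have h4 := Complex.real_le_real.mpr h3
  rw [Complex.ofReal_prod, Complex.ofReal_one] at h4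
  exact h4

open scoped MatrixOrder Matrix.Norms.L2Operator in
-- Writing `P = Rᴴ R` with `R` invertible turns `P + S` into `Rᴴ (1 + T) R` with `T` positive
-- semidefinite, which reduces to the case `P = 1`.
theorem PosDef.det_le_det_add {P S : Matrix n n ℂ} (hP : P.PosDef) (hS : S.PosSemidef) :
    P.det ≤ (P + S).det := by
  obtain ⟨R, hR, rfl⟩ : ∃ R : Matrix n n ℂ, IsUnit R.det ∧ P = Rᴴ * R := by
    obtain ⟨R, hR⟩ := CStarAlgebra.nonneg_iff_eq_star_mul_self.mp hP.posSemidef.nonneg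
    refine ⟨R, ?_, hR⟩
    have := hP.det_pos.ne'
    rw [hR, det_mul] at this
    exact (right_ne_zero_of_mul this).isUnit
  have h1 : Rᴴ * R + S = Rᴴ * (1 + (R⁻¹)ᴴ * S * R⁻¹) * R := by
    have h2 : Rᴴ * (R⁻¹)ᴴ = 1 := by
      rw [← conjTranspose_mul, nonsing_inv_mul _ hR, conjTranspose_one]
    rw [mul_add, add_mul, mul_one, ← mul_assoc, ← mul_assoc, h2, one_mul, mul_assoc,
      nonsing_inv_mul _ hR, mul_one]
  rw [h1, det_mul, det_mul, det_mul, mul_right_comm, ← det_mul]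
  exact le_mul_of_one_le_right hP.det_pos.le
    (hS.conjTranspose_mul_mul_same R⁻¹).one_le_det_one_add

/-- The Schur complement of `A` in the matrix with corner `D + Q` is `Q` plus the Schur complement
for the corner `D`, and the latter is positive semidefinite. -/
theorem PosSemidef.det_mul_det_le_det_fromBlocks {A : Matrix m m ℂ} {B : Matrix m n ℂ}
    {D Q : Matrix n n ℂ} (h : (fromBlocks A B Bᴴ D).PosSemidef) (hA : A.PosDef) (hQ : Q.PosDef) :
    A.det * Q.det ≤ (fromBlocks A B Bᴴ (D + Q)).det := by
  have := hA.isUnit.invertible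
  rw [hA.fromBlocks₁₁] at h
  rw [det_fromBlocks₁₁, invOf_eq_nonsing_inv,
    show D + Q - Bᴴ * A⁻¹ * B = Q + (D - Bᴴ * A⁻¹ * B) by abel]
  exact mul_le_mul_of_nonneg_left (hQ.det_le_det_add h) hA.det_pos.le

end Matrix

/-! ### Pseudo-bases of lattices over Dedekind domains. -/

/-- A pseudo-basis of an `R`-submodule `Λ` of a `K`-vector space: linearly independent vectors
`b i` and nonzero fractional ideals `𝔞 i` such that `Λ = ⨁ 𝔞 i • b i`. -/
structure IsPseudoBasis {R K G ι : Type*} [CommRing R] [Field K] [Algebra R K] [AddCommGroup G]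
    [Module R G] [Module K G] [Fintype ι] (Λ : Submodule R G) (b : ι → G)
    (𝔞 : ι → FractionalIdeal R⁰ K) : Prop where
  linearIndependent : LinearIndependent K b
  ne_zero : ∀ i, 𝔞 i ≠ 0
  mem_iff : ∀ x, x ∈ Λ ↔ ∃ a : ι → K, (∀ i, a i ∈ 𝔞 i) ∧ x = ∑ i, a i • b i

section pseudoBasis

variable {R K G H ι κ : Type*} [CommRing R] [Field K] [Algebra R K] [AddCommGroup G]
  [Module R G] [Module K G] [AddCommGroup H] [Module R H] [Module K H] [Fintype ι] [Fintype κ]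

theorem FractionalIdeal.exists_ne_zero_mem {I : FractionalIdeal R⁰ K} (hI : I ≠ 0) :
    ∃ a ∈ I, a ≠ 0 := by
  by_contra! h
  exact hI (FractionalIdeal.eq_zero_iff.mpr h)

namespace IsPseudoBasis

variable {Λ : Submodule R G} {b : ι → G} {𝔞 : ι → FractionalIdeal R⁰ K}

theorem smul_mem (h : IsPseudoBasis Λ b 𝔞) (i : ι) {a : K} (ha : a ∈ 𝔞 i) : a • b i ∈ Λ := by
  classical
  refine (h.mem_iff _).mpr ⟨Pi.single i a, fun j => ?_, ?_⟩
  · obtain rfl | hj := eq_or_ne j i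
    · simpa using ha
    · simpa [hj] using (𝔞 j).zero_mem
  · rw [Finset.sum_eq_single i (fun j _ hj => by simp [hj]) (by simp)]
    simp

theorem mem_of_le (h : IsPseudoBasis Λ b 𝔞) {W : Submodule K G} (hW : (Λ : Set G) ⊆ W) (i : ι) :
    b i ∈ W := by
  obtain ⟨a, ha, ha0⟩ := FractionalIdeal.exists_ne_zero_mem (h.ne_zero i)
  have := W.smul_mem a⁻¹ (hW (h.smul_mem i ha))
  rwa [smul_smul, inv_mul_cancel₀ ha0, one_smul] at this

end IsPseudoBasis

variable [IsDedekindDomain R] [IsFractionRing R K] [IsScalarTower R K G] [IsScalarTower R K H]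

theorem FractionalIdeal.mul_smul_mem_of_mem_inv {I : FractionalIdeal R⁰ K} (hI : I ≠ 0)
    {Λ : Submodule R G} {c d : K} (hc : c ∈ I) (hd : d ∈ I⁻¹) {x : G} (hx : x ∈ Λ) :
    (c * d) • x ∈ Λ := by
  have h := FractionalIdeal.mul_mem_mul hc hd
  rw [mul_inv_cancel₀ hI, FractionalIdeal.mem_one_iff] at h
  obtain ⟨r, hr⟩ := h
  rw [← hr, algebraMap_smul]
  exact Λ.smul_mem r hx

/-- This is the projectivity of `I`: write `1 = ∑ c k * d k` with `c k ∈ I`, `d k ∈ I⁻¹`, lift each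
`c k • w` to some `l k ∈ Λ`, and take `z = ∑ d k • l k`. -/
theorem FractionalIdeal.exists_lift_of_smul_mem_map (π : G →ₗ[K] H) (Λ : Submodule R G)
    {I : FractionalIdeal R⁰ K} (hI : I ≠ 0) (w : H)
    (hw : ∀ c ∈ I, c • w ∈ Λ.map (π.restrictScalars R)) :
    ∃ z, π z = w ∧ ∀ c ∈ I, c • z ∈ Λ := by
  -- Replacing `1` by an arbitrary `t ∈ I * I⁻¹` makes the claim additive, so that it can be checked
  -- on products.
  have key : ∀ t ∈ I * I⁻¹, ∃ z, π z = t • w ∧ ∀ c ∈ I, c • z ∈ Λ := by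
    intro t ht
    refine FractionalIdeal.mul_induction_on ht (fun c hc d hd => ?_) (fun s t hs ht => ?_)
    · obtain ⟨l, hl, hlw⟩ := hw c hc
      refine ⟨d • l, ?_, fun e he => ?_⟩
      · rw [map_smul, mul_comm, mul_smul, ← hlw]
        rfl
      · rw [smul_smul]
        exact FractionalIdeal.mul_smul_mem_of_mem_inv hI he hd hl
    · obtain ⟨z, hz, hz'⟩ := hs
      obtain ⟨y, hy, hy'⟩ := ht
      exact ⟨z + y, by rw [map_add, hz, hy, add_smul], fun c hc => by
        rw [smul_add]; exact add_mem (hz' c hc) (hy' c hc)⟩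
  simpa using key 1 (by rw [mul_inv_cancel₀ hI]; exact FractionalIdeal.one_mem_one _)

/-- A pseudo-basis of the kernel and one of the image of a linear map on a lattice combine to a
pseudo-basis of the lattice. -/
theorem IsPseudoBasis.exists_extension (π : G →ₗ[K] H) {Λ : Submodule R G} {u : ι → G} {w : κ → H}
    {𝔠 : ι → FractionalIdeal R⁰ K} {𝔢 : κ → FractionalIdeal R⁰ K}
    (hu : IsPseudoBasis (Λ ⊓ (LinearMap.ker π).restrictScalars R) u 𝔠)
    (hw : IsPseudoBasis (Λ.map (π.restrictScalars R)) w 𝔢) :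
    ∃ z : κ → G, (∀ j, π (z j) = w j) ∧ IsPseudoBasis Λ (Sum.elim u z) (Sum.elim 𝔠 𝔢) := by
  have h := fun j => FractionalIdeal.exists_lift_of_smul_mem_map π Λ (hw.ne_zero j) (w j)
    (fun c hc => hw.smul_mem j hc)
  choose z hz hzΛ using h
  have hπu : ∀ i, π (u i) = 0 := fun i =>
    hu.mem_of_le (W := LinearMap.ker π) (fun x hx => hx.2) i
  refine ⟨z, hz, ?_, ?_, fun x => ⟨fun hx => ?_, ?_⟩⟩
  · rw [Fintype.linearIndependent_iff]
    intro g hg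
    simp only [Fintype.sum_sum_type, Sum.elim_inl, Sum.elim_inr] at hg
    have h1 : ∀ j, g (Sum.inr j) = 0 := by
      refine Fintype.linearIndependent_iff.mp hw.linearIndependent (fun j => g (Sum.inr j)) ?_
      have := congrArg π hg
      simpa [map_sum, hπu, hz] using this
    have h2 : ∀ i, g (Sum.inl i) = 0 := by
      refine Fintype.linearIndependent_iff.mp hu.linearIndependent (fun j => g (Sum.inl j)) ?_
      simpa [h1] using hg
    rintro (i | j)
    exacts [h2 i, h1 j]
  · rintro (i | j)
    exacts [hu.ne_zero i, hw.ne_zero j]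
  · obtain ⟨e, he, hxe⟩ := (hw.mem_iff (π x)).mp ⟨x, hx, rfl⟩
    have hy : x - ∑ j, e j • z j ∈ Λ ⊓ (LinearMap.ker π).restrictScalars R := by
      refine ⟨sub_mem hx (sum_mem fun j _ => hzΛ j _ (he j)), ?_⟩
      change π _ = 0
      simp [hxe, hz]
    obtain ⟨c, hc, hxc⟩ := (hu.mem_iff _).mp hy
    refine ⟨Sum.elim c e, ?_, ?_⟩
    · rintro (i | j)
      exacts [hc i, he j]
    · simp [← hxc]
  · rintro ⟨a, ha, rfl⟩
    simp only [Fintype.sum_sum_type, Sum.elim_inl, Sum.elim_inr]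
    exact add_mem (sum_mem fun i _ => (hu.smul_mem i (ha (Sum.inl i))).1)
      (sum_mem fun j _ => hzΛ j _ (ha (Sum.inr j)))

/-- Finitely generated submodules of vector spaces have pseudo-bases. -/
theorem Submodule.FG.exists_isPseudoBasis [Module.Finite K G] (Λ : Submodule R G) (hΛ : Λ.FG) :
    ∃ (ι : Type) (_ : Fintype ι) (b : ι → G) (𝔞 : ι → FractionalIdeal R⁰ K),
      IsPseudoBasis Λ b 𝔞 := by
  -- Induction on the dimension of a subspace containing `Λ`: a linear form not vanishing on `Λ`
  -- cuts this dimension down.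
  suffices h : ∀ (k : ℕ) (S : Submodule K G), finrank K S ≤ k → ∀ Λ : Submodule R G, Λ.FG →
      (Λ : Set G) ⊆ S → ∃ (ι : Type) (_ : Fintype ι) (b : ι → G)
        (𝔞 : ι → FractionalIdeal R⁰ K), IsPseudoBasis Λ b 𝔞 from
    h _ ⊤ le_rfl Λ hΛ (Set.subset_univ _)
  have triv : ∃ (ι : Type) (_ : Fintype ι) (b : ι → G) (𝔞 : ι → FractionalIdeal R⁰ K),
      IsPseudoBasis (⊥ : Submodule R G) b 𝔞 :=
    ⟨Empty, inferInstance, Empty.elim, Empty.elim, linearIndependent_empty_type, nofun,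
      fun x => by simp⟩
  intro k
  induction k with
  | zero =>
    intro S hS Λ _ hΛS
    rw [Nat.le_zero, Submodule.finrank_eq_zero] at hS
    obtain rfl : Λ = ⊥ := (Submodule.eq_bot_iff _).mpr fun x hx => by
      simpa [hS] using hΛS hx
    exact triv
  | succ k ih =>
    intro S hS Λ hΛ hΛS
    obtain rfl | hne := eq_or_ne Λ ⊥
    · exact triv
    obtain ⟨x, hx, hx0⟩ := Λ.exists_mem_ne_zero_of_ne_bot hne
    obtain ⟨π, hπ⟩ : ∃ π : G →ₗ[K] K, π x ≠ 0 := by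
      by_contra! h
      exact hx0 ((Module.forall_dual_apply_eq_zero_iff K x).mp h)
    have hlt : S ⊓ LinearMap.ker π < S :=
      inf_le_left.lt_of_ne fun h => hπ (inf_eq_left.mp h (hΛS hx))
    have hfg : (Λ ⊓ (LinearMap.ker π).restrictScalars R).FG := by
      have := isNoetherian_of_fg_of_noetherian Λ hΛ
      exact hΛ.of_le inf_le_left
    obtain ⟨ι, _, u, 𝔠, hu⟩ := ih (S ⊓ LinearMap.ker π)
      (by have := Submodule.finrank_lt_finrank_of_lt hlt; omega) _ hfg
      (fun y hy => ⟨hΛS hy.1, hy.2⟩)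
    -- The image of `Λ` under the linear form is itself a nonzero fractional ideal, with basis
    -- vector `1`.
    have hJ : IsPseudoBasis (Λ.map (π.restrictScalars R)) (fun _ : Unit => (1 : K))
        (fun _ => ⟨Λ.map (π.restrictScalars R), FractionalIdeal.isFractional_of_fg (hΛ.map _)⟩) := by
      refine ⟨by simp, fun _ h => hπ ?_, fun y => ⟨fun hy => ⟨fun _ => y, fun _ => hy, by simp⟩, ?_⟩⟩
      · exact FractionalIdeal.eq_zero_iff.mp h _ ⟨x, hx, rfl⟩
      · rintro ⟨a, ha, rfl⟩
        have h := ha ()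
        rw [Fintype.sum_unique, smul_eq_mul, mul_one]
        exact h
    obtain ⟨z, _, hz⟩ := hu.exists_extension π hJ
    exact ⟨ι ⊕ Unit, inferInstance, _, _, hz⟩

end pseudoBasis

/-! ### Gram determinants in a tensor product. -/

noncomputable section

variable {K : Type*} [Field K]

namespace SesqForm

variable {E F : Type*} [AddCommGroup E] [Module K E] [AddCommGroup F] [Module K F]
  {v : InfinitePlace K}

theorem gram_posSemidef (h : SesqForm v E) {ι κ : Type*} [Fintype ι] [Fintype κ] (b : Basis ι K E)
    (hb : (h.gram b).PosDef) (c : κ → E) : (h.gram c).PosSemidef := by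
  rw [h.gram_change b c (Matrix.of fun i j => b.repr (c j) i) (fun j => by simp)]
  exact hb.posSemidef.conjTranspose_mul_mul_same _

/-- If `α = h' d d` and `δ` is the squared length of the projection of `f` orthogonal to `d`, the
Gram determinant of the vectors `u i ⊗ d` and `x j ⊗ d + w j ⊗ f` is at least
`α ^ p * det (gram u) * (δ ^ q * det (gram w))`. -/
theorem det_gram_mul_le (h : SesqForm v E) (h' : SesqForm v F) {ι κ μ : Type*} [Fintype ι]
    [Fintype κ] [DecidableEq ι] [DecidableEq κ] [Fintype μ] (e : Basis μ K E)
    (he : (h.gram e).PosDef) {d f : F} {α δ : ℂ} (hα : 0 < α) (hδ : 0 < δ) (hd : h' d d = α)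
    (hfd : starRingEnd ℂ (h' d f) = h' f d) (hf : α * δ = α * h' f f - h' d f * h' f d)
    {u : ι → E} {w : κ → E} (hu : LinearIndependent K u) (hw : LinearIndependent K w)
    (x : κ → E) :
    α ^ Fintype.card ι * (h.gram u).det * (δ ^ Fintype.card κ * (h.gram w).det) ≤
      ((tensorForm h h').gram (Sum.elim (fun i => u i ⊗ₜ[K] d)
        (fun j => x j ⊗ₜ[K] d + w j ⊗ₜ[K] f))).det := by
  set s : ι ⊕ κ → E := Sum.elim u x with hs
  set t : ι ⊕ κ → E := Sum.elim 0 w with ht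
  -- With `β = h' d f`, the component of `f` along `d` is `(β / α) d`, so the vectors of the family
  -- are `(s + (β / α) t) ⊗ d + t ⊗ f'` with `f'` orthogonal to `d`. `G` is the Gram matrix of the
  -- parts along `d`. Since `β` need not come from `K`, these are not vectors of `E ⊗ F`, and the
  -- combination is made by a complex matrix instead.
  let C : Matrix ((ι ⊕ κ) ⊕ (ι ⊕ κ)) (ι ⊕ κ) ℂ :=
    Matrix.fromRows (Matrix.diagonal fun _ => α) (Matrix.diagonal fun _ => h' d f)
  let G : Matrix (ι ⊕ κ) (ι ⊕ κ) ℂ := α⁻¹ • (C.conjTranspose * h.gram (Sum.elim s t) * C)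
  have hG : G.PosSemidef :=
    ((h.gram_posSemidef e he _).conjTranspose_mul_mul_same C).smul (inv_pos.mpr hα).le
  have hαs : starRingEnd ℂ α = α := (Complex.conj_eq_iff_im.mpr (Complex.lt_def.mp hα).2.symm)
  have hα0 : α ≠ 0 := hα.ne'
  have hGa : ∀ k l, G k l = α * h (s k) (s l) + h' d f * h (s k) (t l) +
      h' f d * h (t k) (s l) + α⁻¹ * (h' f d * h' d f) * h (t k) (t l) := by
    intro k l
    have hC : h.gram (Sum.elim s t) = Matrix.fromBlocks
        (Matrix.of fun k l => h (s k) (s l)) (Matrix.of fun k l => h (s k) (t l))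
        (Matrix.of fun k l => h (t k) (s l)) (Matrix.of fun k l => h (t k) (t l)) := by
      ext (i | i) (j | j) <;> rfl
    have hst : ∀ c : ℂ, (Matrix.diagonal fun _ : ι ⊕ κ => c).conjTranspose =
        Matrix.diagonal fun _ => starRingEnd ℂ c := fun c => Matrix.diagonal_conjTranspose _
    simp only [G, C, hC, Matrix.conjTranspose_fromRows_eq_fromCols_conjTranspose,
      Matrix.fromCols_mul_fromBlocks, Matrix.fromCols_mul_fromRows, hst,
      Matrix.smul_apply, Matrix.add_apply, Matrix.mul_diagonal, Matrix.diagonal_mul,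
      Matrix.of_apply, smul_eq_mul, hαs, hfd]
    field_simp
    ring
  -- The parts along `f'` contribute `δ • h.gram w`, in the lower right block only.
  have hgram : (tensorForm h h').gram (Sum.elim (fun i => u i ⊗ₜ[K] d)
        (fun j => x j ⊗ₜ[K] d + w j ⊗ₜ[K] f)) =
      Matrix.fromBlocks G.toBlocks₁₁ G.toBlocks₁₂ G.toBlocks₁₂.conjTranspose
        (G.toBlocks₂₂ + δ • h.gram w) := by
    have h21 : G.toBlocks₁₂.conjTranspose = G.toBlocks₂₁ := by
      ext i j
      exact hG.1.apply _ _
    have hff : h' f f = α⁻¹ * (h' f d * h' d f) + δ := by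
      field_simp
      rw [add_comm, hf]
      ring
    rw [h21]
    ext (i | i) (j | j) <;>
    simp [SesqForm.gram, Matrix.toBlocks₁₁, Matrix.toBlocks₁₂, Matrix.toBlocks₂₁,
        Matrix.toBlocks₂₂, hGa, hs, ht, hd, hff] <;> ring
  have h11 : G.toBlocks₁₁ = α • h.gram u := by
    ext i j
    simp [SesqForm.gram, Matrix.toBlocks₁₁, hGa, hs, ht]
  have hGb : (Matrix.fromBlocks G.toBlocks₁₁ G.toBlocks₁₂ G.toBlocks₁₂.conjTranspose
      G.toBlocks₂₂).PosSemidef := by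
    have h21 : G.toBlocks₁₂.conjTranspose = G.toBlocks₂₁ := by
      ext i j
      exact hG.1.apply _ _
    rwa [h21, Matrix.fromBlocks_toBlocks]
  rw [hgram, ← Matrix.det_smul, ← Matrix.det_smul, ← h11]
  refine hGb.det_mul_det_le_det_fromBlocks ?_ ?_
  · rw [h11]
    exact (h.gram_posDef e he u hu).smul hα
  · exact (h.gram_posDef e he w hw).smul hδ

end SesqForm

/-! ### Weighted norms and their relation to heights. -/

namespace RigidAdelicSpace

variable [NumberField K]

/-- The weighted norm `N(I) * ∏ v, g v ^ (e_v / 2)` of a fractional ideal together with a family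
of real numbers at the infinite places. -/
def weightedNorm (I : FractionalIdeal (𝓞 K)⁰ K) (g : InfinitePlace K → ℝ) : ℝ :=
  ((FractionalIdeal.absNorm I : ℚ) : ℝ) * ∏ v : InfinitePlace K, g v ^ ((v.mult : ℝ) / 2)

theorem weightedNorm_nonneg (I : FractionalIdeal (𝓞 K)⁰ K) {g : InfinitePlace K → ℝ}
    (hg : 0 ≤ g) : 0 ≤ weightedNorm I g :=
  mul_nonneg (by exact_mod_cast FractionalIdeal.absNorm_nonneg I)
    (Finset.prod_nonneg fun v _ => Real.rpow_nonneg (hg v) _)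

theorem weightedNorm_pos {I : FractionalIdeal (𝓞 K)⁰ K} (hI : I ≠ 0) {g : InfinitePlace K → ℝ}
    (hg : ∀ v, 0 < g v) : 0 < weightedNorm I g := by
  refine mul_pos ?_ (Finset.prod_pos fun v _ => Real.rpow_pos_of_pos (hg v) _)
  have h : FractionalIdeal.absNorm I ≠ 0 := fun h => hI (FractionalIdeal.absNorm_eq_zero_iff.mp h)
  exact_mod_cast (FractionalIdeal.absNorm_nonneg I).lt_of_ne' h

theorem weightedNorm_mul (I J : FractionalIdeal (𝓞 K)⁰ K) {g g' : InfinitePlace K → ℝ}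
    (hg : 0 ≤ g) (hg' : 0 ≤ g') :
    weightedNorm (I * J) (g * g') = weightedNorm I g * weightedNorm J g' := by
  have : ∀ v, (g * g') v ^ ((InfinitePlace.mult v : ℝ) / 2) =
      g v ^ ((v.mult : ℝ) / 2) * g' v ^ ((v.mult : ℝ) / 2) := fun v =>
    Real.mul_rpow (hg v) (hg' v)
  simp only [weightedNorm, map_mul, Rat.cast_mul, this, Finset.prod_mul_distrib]
  ring

theorem weightedNorm_pow (I : FractionalIdeal (𝓞 K)⁰ K) {g : InfinitePlace K → ℝ}
    (hg : 0 ≤ g) (k : ℕ) : weightedNorm (I ^ k) (g ^ k) = weightedNorm I g ^ k := by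
  induction k with
  | zero => simp [weightedNorm]
  | succ k ih => rw [pow_succ, pow_succ, pow_succ, weightedNorm_mul _ _ (pow_nonneg hg k) hg, ih]

theorem weightedNorm_mono (I : FractionalIdeal (𝓞 K)⁰ K) {g g' : InfinitePlace K → ℝ}
    (hg : 0 ≤ g) (h : g ≤ g') : weightedNorm I g ≤ weightedNorm I g' :=
  mul_le_mul_of_nonneg_left
    (Finset.prod_le_prod (fun v _ => Real.rpow_nonneg (hg v) _) fun v _ =>
      Real.rpow_le_rpow (hg v) (h v) (by positivity))
    (by exact_mod_cast FractionalIdeal.absNorm_nonneg I)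

/-- `I = A * J` with `A` a nonzero integral ideal, whose norm is at least `1`. -/
theorem absNorm_anti {I J : FractionalIdeal (𝓞 K)⁰ K} (hI : I ≠ 0) (h : I ≤ J) :
    FractionalIdeal.absNorm J ≤ FractionalIdeal.absNorm I := by
  have hJ : J ≠ 0 := fun hJ => hI (by simpa [hJ] using h)
  have h1 : I * J⁻¹ ≤ 1 := by
    rw [← mul_inv_cancel₀ hJ]
    exact mul_le_mul_left h _
  obtain ⟨A, hA⟩ := FractionalIdeal.le_one_iff_exists_coeIdeal.mp h1
  have hIJ : I = (A : FractionalIdeal (𝓞 K)⁰ K) * J := by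
    rw [hA, mul_assoc, inv_mul_cancel₀ hJ, mul_one]
  have hA0 : A ≠ ⊥ := by
    rintro rfl
    exact hI (by simp [hIJ])
  rw [hIJ, map_mul, FractionalIdeal.coeIdeal_absNorm]
  refine le_mul_of_one_le_left (FractionalIdeal.absNorm_nonneg J) ?_
  have := Nat.pos_of_ne_zero (mt Ideal.absNorm_eq_zero_iff.mp hA0)
  exact_mod_cast this

theorem weightedNorm_anti {I J : FractionalIdeal (𝓞 K)⁰ K} (hI : I ≠ 0) (h : I ≤ J)
    {g : InfinitePlace K → ℝ} (hg : 0 ≤ g) : weightedNorm J g ≤ weightedNorm I g :=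
  mul_le_mul_of_nonneg_right (by exact_mod_cast absNorm_anti hI h)
    (Finset.prod_nonneg fun v _ => Real.rpow_nonneg (hg v) _)

variable {E : Type*} [AddCommGroup E] [Module K E] [Module (𝓞 K) E] [IsScalarTower (𝓞 K) K E]
variable {F : Type*} [AddCommGroup F] [Module K F] [Module (𝓞 K) F] [IsScalarTower (𝓞 K) K F]
variable {ι : Type*} [Fintype ι]

/-- The Gram determinants of a family of vectors at the infinite places. -/
def gramDet [DecidableEq ι] (X : RigidAdelicSpace K E) (b : ι → E) (v : InfinitePlace K) : ℝ :=
  ((X.form v).gram b).det.re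

theorem gram_posDef (X : RigidAdelicSpace K E) {b : ι → E} (hb : LinearIndependent K b)
    (v : InfinitePlace K) : ((X.form v).gram b).PosDef := by
  have := X.finiteDimensional
  exact (X.form v).gram_posDef (finBasis K E) (X.posDef v _ _) b hb

theorem ofReal_gramDet [DecidableEq ι] (X : RigidAdelicSpace K E) {b : ι → E} (hb : LinearIndependent K b)
    (v : InfinitePlace K) : (X.gramDet b v : ℂ) = ((X.form v).gram b).det :=
  (Complex.eq_re_of_ofReal_le (r := 0) (by simpa using (X.gram_posDef hb v).det_pos.le)).symm

theorem gramDet_pos [DecidableEq ι] (X : RigidAdelicSpace K E) {b : ι → E} (hb : LinearIndependent K b)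
    (v : InfinitePlace K) : 0 < X.gramDet b v :=
  (Complex.lt_def.mp (X.gram_posDef hb v).det_pos).1

theorem gramDet_nonneg [DecidableEq ι] (X : RigidAdelicSpace K E) {b : ι → E} (hb : LinearIndependent K b) :
    0 ≤ X.gramDet b := fun v => (X.gramDet_pos hb v).le

theorem minHeight_nonneg (X : RigidAdelicSpace K E) : 0 ≤ X.minHeight := by
  refine Real.sInf_nonneg ?_
  rintro _ ⟨W, -, rfl⟩
  refine Real.rpow_nonneg (Real.rpow_nonneg (mul_nonneg ?_ ?_) _) _
  · exact_mod_cast FractionalIdeal.absNorm_nonneg _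
  · exact Finset.prod_nonneg fun v _ => Real.rpow_nonneg ((X.restrict W).gram_det_pos v _).le _

theorem heightIn_eq_weightedNorm [DecidableEq ι] (X : RigidAdelicSpace K E) (b : Basis ι K E) :
    X.heightIn b = weightedNorm (X.detIdeal b) (X.gramDet b) ^ (1 / (finrank ℚ K : ℝ)) := rfl

theorem height_eq_heightIn [DecidableEq ι] (X : RigidAdelicSpace K E) (b : Basis ι K E) :
    X.height = X.heightIn b := by
  have := X.finiteDimensional
  rw [height, X.heightIn_eq _ b]

theorem height_nonneg (X : RigidAdelicSpace K E) : 0 ≤ X.height := by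
  have := X.finiteDimensional
  rw [X.height_eq_heightIn (finBasis K E), heightIn_eq_weightedNorm]
  exact Real.rpow_nonneg (weightedNorm_nonneg _
    (X.gramDet_nonneg (finBasis K E).linearIndependent)) _

theorem reducedHeight_nonneg (X : RigidAdelicSpace K E) : 0 ≤ X.reducedHeight :=
  Real.rpow_nonneg X.height_nonneg _

theorem reducedHeight_pow_finrank (X : RigidAdelicSpace K E) (h : finrank K E ≠ 0) :
    X.reducedHeight ^ finrank K E = X.height := by
  rw [reducedHeight, ← Real.rpow_natCast, ← Real.rpow_mul X.height_nonneg, one_div,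
    inv_mul_cancel₀ (by exact_mod_cast h), Real.rpow_one]

/-- A product `∏ g i` with `g i ∈ 𝔤 i` is the determinant of the lattice vectors `g i • b i`. -/
theorem prod_le_detIdeal [DecidableEq ι] (X : RigidAdelicSpace K E) (b : Basis ι K E)
    (𝔤 : ι → FractionalIdeal (𝓞 K)⁰ K) (h : ∀ i, ∀ c ∈ 𝔤 i, c • b i ∈ X.lattice) :
    ∏ i, 𝔤 i ≤ X.detIdeal b := by
  rw [← FractionalIdeal.coe_le_coe]
  change FractionalIdeal.coeSubmoduleHom _ _ _ ≤ Submodule.span _ _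
  rw [map_prod]
  change ∏ i, (𝔤 i : Submodule (𝓞 K) K) ≤ _
  rw [Finset.prod_congr rfl fun i _ => (Submodule.span_eq (𝔤 i : Submodule (𝓞 K) K)).symm,
    Submodule.prod_span]
  refine Submodule.span_mono fun x hx => ?_
  rw [Set.mem_finsetProd] at hx
  obtain ⟨g, hg, rfl⟩ := hx
  refine ⟨fun i => g i • b i, fun i => h i _ (hg (Finset.mem_univ i)), ?_⟩
  rw [AlternatingMap.map_smul_univ, Basis.det_self]
  simp

/-- Linearly independent vectors `u i` and fractional ideals `𝔤 i` with `𝔤 i • u i` in the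
lattice give an upper bound for `H_min`. -/
theorem minHeight_pow_le [DecidableEq ι] (X : RigidAdelicSpace K E) {u : ι → E} (hu : LinearIndependent K u)
    {𝔤 : ι → FractionalIdeal (𝓞 K)⁰ K} (h0 : ∀ i, 𝔤 i ≠ 0)
    (h : ∀ i, ∀ c ∈ 𝔤 i, c • u i ∈ X.lattice) :
    X.minHeight ^ (finrank ℚ K * Fintype.card ι) ≤ weightedNorm (∏ i, 𝔤 i) (X.gramDet u) := by
  -- For the empty family both sides are `1`. This case matters: `U` or `V` may be zero.
  obtain hι | hι := isEmpty_or_nonempty ι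
  · simp [weightedNorm, gramDet]
  set W := Submodule.span K (Set.range u)
  let b : Basis ι K W := Basis.span hu
  have hb : ∀ i, (b i : E) = u i := fun i => congrArg Subtype.val (Basis.span_apply hu i)
  have hW : W ≠ ⊥ := by
    obtain ⟨i⟩ := hι
    exact fun h => hu.ne_zero i ((Submodule.mem_bot K).mp (h ▸ hb i ▸ (b i).2))
  have hmin : X.minHeight ≤ (X.restrict W).reducedHeight := by
    refine csInf_le ⟨0, ?_⟩ ⟨W, hW, rfl⟩
    rintro _ ⟨V, -, rfl⟩
    exact reducedHeight_nonneg _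
  have hcard : finrank K W = Fintype.card ι := finrank_eq_card_basis b
  have hg : (X.restrict W).gramDet b = X.gramDet u := by
    funext v
    have : ((X.restrict W).form v).gram b = (X.form v).gram u := by
      ext i j
      change X.form v (b i : E) (b j : E) = _
      rw [hb, hb]
      rfl
    rw [gramDet, gramDet, this]
  -- The ideals only span a sublattice of `L ∩ W`; its determinant ideal is smaller, hence of larger
  -- norm.
  have hle : (X.restrict W).height ^ finrank ℚ K ≤ weightedNorm (∏ i, 𝔤 i) (X.gramDet u) := by
    rw [(X.restrict W).height_eq_heightIn b, heightIn_eq_weightedNorm, hg, ← Real.rpow_natCast,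
      ← Real.rpow_mul (weightedNorm_nonneg _ (X.gramDet_nonneg hu)), one_div,
      inv_mul_cancel₀ (by exact_mod_cast finrank_pos.ne'), Real.rpow_one]
    refine weightedNorm_anti (Finset.prod_ne_zero_iff.mpr fun i _ => h0 i)
      ((X.restrict W).prod_le_detIdeal b 𝔤 fun i c hc => ?_) (X.gramDet_nonneg hu)
    change ((c • b i : W) : E) ∈ X.lattice
    rw [Submodule.coe_smul, hb]
    exact h i c hc
  calc X.minHeight ^ (finrank ℚ K * Fintype.card ι)
      ≤ (X.restrict W).reducedHeight ^ (finrank ℚ K * Fintype.card ι) :=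
        pow_le_pow_left₀ X.minHeight_nonneg hmin _
    _ = (X.restrict W).height ^ finrank ℚ K := by
        rw [mul_comm, pow_mul, ← hcard,
          reducedHeight_pow_finrank _ (by rw [hcard]; exact Fintype.card_ne_zero)]
    _ ≤ _ := hle

theorem basis_of_isPseudoBasis (X : RigidAdelicSpace K E) {b : ι → E}
    {𝔞 : ι → FractionalIdeal (𝓞 K)⁰ K} (h : IsPseudoBasis X.lattice b 𝔞) :
    ∃ B : Basis ι K E, ⇑B = b := by
  refine ⟨Basis.mk h.linearIndependent ?_, Basis.coe_mk _ _⟩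
  rw [← X.isLattice.span_eq_top, Submodule.span_le]
  intro x hx
  obtain ⟨a, -, rfl⟩ := (h.mem_iff x).mp hx
  exact sum_mem fun i _ => Submodule.smul_mem _ _ (Submodule.subset_span ⟨i, rfl⟩)

/-- The exponent clears both roots in `H_r`, so that later comparisons take place between integral
powers. -/
theorem reducedHeight_pow_eq [DecidableEq ι] (X : RigidAdelicSpace K E) [Nonempty ι] {b : ι → E}
    {𝔞 : ι → FractionalIdeal (𝓞 K)⁰ K} (h : IsPseudoBasis X.lattice b 𝔞) :
    X.reducedHeight ^ (finrank ℚ K * Fintype.card ι) =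
      weightedNorm (∏ i, 𝔞 i) (X.gramDet b) := by
  obtain ⟨B, rfl⟩ := X.basis_of_isPseudoBasis h
  have hL : ∀ x, x ∈ X.lattice ↔ ∀ i, B.repr x i ∈ 𝔞 i := by
    intro x
    rw [h.mem_iff]
    constructor
    · rintro ⟨a, ha, rfl⟩ i
      rw [B.repr_sum_self]
      exact ha i
    · exact fun hx => ⟨fun i => B.repr x i, hx, (B.sum_repr x).symm⟩
  have hcard : finrank K E = Fintype.card ι := finrank_eq_card_basis B
  have hH : X.height = weightedNorm (∏ i, 𝔞 i) (X.gramDet B) ^ (1 / (finrank ℚ K : ℝ)) :=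
    X.height_eq_of_pseudoBasis B 𝔞 hL
  rw [mul_comm, pow_mul, ← hcard,
    reducedHeight_pow_finrank _ (by rw [hcard]; exact Fintype.card_ne_zero), hH,
    ← Real.rpow_natCast,
    ← Real.rpow_mul (weightedNorm_nonneg _ (X.gramDet_nonneg h.linearIndependent)),
    one_div, inv_mul_cancel₀ (by exact_mod_cast finrank_pos.ne'), Real.rpow_one]

end RigidAdelicSpace

/-! ### Tools: products of infima, transport of pseudo-bases, contraction of tensors. -/

/-- Lets `H_min` be compared with a product of infima without knowing that they are attained. The
bound passes to one infimum at a time by dividing by the other factor; a zero factor is treated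
apart. -/
theorem Real.le_sInf_mul_sInf {s t : Set ℝ} (hs : s.Nonempty) (ht : t.Nonempty)
    (hs0 : ∀ x ∈ s, 0 ≤ x) (ht0 : ∀ y ∈ t, 0 ≤ y) {m : ℝ} (h : ∀ x ∈ s, ∀ y ∈ t, m ≤ x * y) :
    m ≤ sInf s * sInf t := by
  have key : ∀ {s : Set ℝ}, s.Nonempty → (∀ x ∈ s, 0 ≤ x) → ∀ {y : ℝ}, 0 ≤ y →
      (∀ x ∈ s, m ≤ x * y) → m ≤ sInf s * y := by
    intro s hs hs0 y hy h
    obtain rfl | hy := hy.eq_or_lt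
    · obtain ⟨x, hx⟩ := hs
      simpa using h x hx
    · rw [← div_le_iff₀ hy]
      exact le_csInf hs fun x hx => (div_le_iff₀ hy).mpr (h x hx)
  rw [mul_comm]
  refine key ht ht0 (Real.sInf_nonneg hs0) fun y hy => ?_
  rw [mul_comm]
  exact key hs hs0 (ht0 y hy) fun x hx => h x hx y hy

namespace IsPseudoBasis

variable {R G ι κ : Type*} [CommRing R] [Algebra R K] [AddCommGroup G] [Module R G] [Module K G]
  [Fintype ι] [Fintype κ]

theorem reindex {Λ : Submodule R G} {b : ι → G} {𝔞 : ι → FractionalIdeal R⁰ K}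
    (h : IsPseudoBasis Λ b 𝔞) (e : κ ≃ ι) : IsPseudoBasis Λ (b ∘ e) (𝔞 ∘ e) where
  linearIndependent := h.linearIndependent.comp e e.injective
  ne_zero i := h.ne_zero (e i)
  mem_iff x := by
    rw [h.mem_iff]
    constructor
    · rintro ⟨a, ha, rfl⟩
      exact ⟨a ∘ e, fun i => ha (e i), (e.sum_comp fun i => a i • b i).symm⟩
    · rintro ⟨a, ha, rfl⟩
      refine ⟨a ∘ e.symm, fun i => by simpa using ha (e.symm i), ?_⟩
      rw [← e.sum_comp]
      simp

theorem of_comap_subtype [IsScalarTower R K G] {Λ : Submodule R G} {W : Submodule K G} {b : ι → W}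
    {𝔞 : ι → FractionalIdeal R⁰ K}
    (h : IsPseudoBasis (Λ.comap (W.subtype.restrictScalars R)) b 𝔞) :
    IsPseudoBasis (Λ ⊓ W.restrictScalars R) (fun i => (b i : G)) 𝔞 where
  linearIndependent := h.linearIndependent.map' W.subtype (Submodule.ker_subtype W)
  ne_zero := h.ne_zero
  mem_iff x := by
    constructor
    · rintro ⟨hx, hxW⟩
      obtain ⟨a, ha, hxa⟩ := (h.mem_iff ⟨x, hxW⟩).mp hx
      exact ⟨a, ha, by simpa using congrArg W.subtype hxa⟩
    · rintro ⟨a, ha, rfl⟩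
      have h1 : ∑ i, a i • b i ∈ Λ.comap (W.subtype.restrictScalars R) :=
        (h.mem_iff _).mpr ⟨a, ha, rfl⟩
      refine ⟨by simpa using h1, ?_⟩
      exact sum_mem fun i _ => W.smul_mem _ (b i).2

end IsPseudoBasis

section contract

variable {E F : Type*} [AddCommGroup E] [Module K E] [AddCommGroup F] [Module K F]

/-- Contraction of `E ⊗ F` against a linear form on `F`. -/
def TensorProduct.contractRight (φ : F →ₗ[K] K) : E ⊗[K] F →ₗ[K] E :=
  (TensorProduct.rid K E).toLinearMap ∘ₗ LinearMap.lTensor E φ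

@[simp] theorem TensorProduct.contractRight_tmul (φ : F →ₗ[K] K) (x : E) (y : F) :
    TensorProduct.contractRight φ (x ⊗ₜ[K] y) = φ y • x := by
  simp [TensorProduct.contractRight]

theorem TensorProduct.eq_sum_contractRight (B : Basis (Fin 2) K F) (z : E ⊗[K] F) :
    z = TensorProduct.contractRight (B.coord 0) z ⊗ₜ[K] B 0 + TensorProduct.contractRight (B.coord 1) z ⊗ₜ[K] B 1 := by
  induction z using TensorProduct.induction_on with
  | zero => simp
  | add z w hz hw =>
    conv_lhs => rw [hz, hw]
    simp only [map_add, TensorProduct.add_tmul]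
    abel
  | tmul x y =>
    conv_lhs => rw [← B.sum_repr y, Fin.sum_univ_two]
    simp only [TensorProduct.tmul_add, TensorProduct.contractRight_tmul, Basis.coord_apply, TensorProduct.smul_tmul]

end contract

/-! ### Heights of subspaces of a tensor product. -/

namespace RigidAdelicSpace

open TensorProduct (contractRight contractRight_tmul)

variable [NumberField K]
variable {E : Type*} [AddCommGroup E] [Module K E] [Module (𝓞 K) E] [IsScalarTower (𝓞 K) K E]
variable {F : Type*} [AddCommGroup F] [Module K F] [Module (𝓞 K) F] [IsScalarTower (𝓞 K) K F]

theorem exists_isPseudoBasis (X : RigidAdelicSpace K E) :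
    ∃ (ι : Type) (_ : Fintype ι) (b : ι → E) (𝔞 : ι → FractionalIdeal (𝓞 K)⁰ K),
      IsPseudoBasis X.lattice b 𝔞 :=
  have := X.finiteDimensional
  Submodule.FG.exists_isPseudoBasis X.lattice X.isLattice.fg

theorem card_eq_finrank (X : RigidAdelicSpace K E) {ι : Type*} [Fintype ι] {b : ι → E}
    {𝔞 : ι → FractionalIdeal (𝓞 K)⁰ K} (h : IsPseudoBasis X.lattice b 𝔞) :
    Fintype.card ι = finrank K E := by
  obtain ⟨B, -⟩ := X.basis_of_isPseudoBasis h
  exact (finrank_eq_card_basis B).symm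

theorem nonempty_of_isPseudoBasis_restrict (X : RigidAdelicSpace K E) {W : Submodule K E}
    (hW : W ≠ ⊥) {ι : Type*} [Fintype ι] {b : ι → W} {𝔞 : ι → FractionalIdeal (𝓞 K)⁰ K}
    (h : IsPseudoBasis (X.restrict W).lattice b 𝔞) : Nonempty ι := by
  have := X.finiteDimensional
  rw [← Fintype.card_pos_iff, (X.restrict W).card_eq_finrank h]
  have := Submodule.nontrivial_iff_ne_bot.mpr hW
  exact finrank_pos

theorem smul_tmul_mem (X : RigidAdelicSpace K E) (Y : RigidAdelicSpace K F) {x : E} {y : F}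
    {I J : FractionalIdeal (𝓞 K)⁰ K} (hx : ∀ c ∈ I, c • x ∈ X.lattice)
    (hy : ∀ c ∈ J, c • y ∈ Y.lattice) {c : K} (hc : c ∈ I * J) :
    c • x ⊗ₜ[K] y ∈ (X.tensor Y).lattice := by
  refine FractionalIdeal.mul_induction_on hc (fun a ha b hb => ?_) fun a b ha hb => ?_
  · refine Submodule.subset_span ⟨a • x, hx a ha, b • y, hy b hb, ?_⟩
    rw [TensorProduct.smul_tmul_smul]
  · rw [add_smul]
    exact add_mem ha hb

theorem gramDet_tmul (X : RigidAdelicSpace K E) (Y : RigidAdelicSpace K F) {ι κ : Type*}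
    [Fintype ι] [Fintype κ] [DecidableEq ι] [DecidableEq κ] {u : ι → E} {w : κ → F}
    (hu : LinearIndependent K u) (hw : LinearIndependent K w) :
    (X.tensor Y).gramDet (fun p : ι × κ => u p.1 ⊗ₜ[K] w p.2) =
      X.gramDet u ^ Fintype.card κ * Y.gramDet w ^ Fintype.card ι := by
  funext v
  have h : ((X.tensor Y).form v).gram (fun p : ι × κ => u p.1 ⊗ₜ[K] w p.2) =
      Matrix.kroneckerMap (· * ·) ((X.form v).gram u) ((Y.form v).gram w) := by
    ext p q
    exact tensorForm_tmul _ _ _ _ _ _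
  rw [gramDet, h, Matrix.det_kronecker, ← X.ofReal_gramDet hu, ← Y.ofReal_gramDet hw]
  norm_cast

theorem minHeight_of_subsingleton (X : RigidAdelicSpace K E) [Subsingleton E] :
    X.minHeight = 0 := by
  have : {r | ∃ W : Submodule K E, W ≠ ⊥ ∧ r = (X.restrict W).reducedHeight} = ∅ := by
    refine Set.eq_empty_of_forall_notMem ?_
    rintro _ ⟨W, hW, -⟩
    exact hW (Subsingleton.elim _ _)
  rw [minHeight, this, Real.sInf_empty]

/-- Pseudo-bases `u`, `w` of `V`, `V'` give the vectors `u i ⊗ w j` with ideals `𝔞 i * 𝔟 j`, whose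
weighted norm is the required power of `H_r(V) H_r(V')`. The zero spaces are separate because there
`H_min` is `0` by convention. -/
theorem minHeight_tensor_le (X : RigidAdelicSpace K E) (Y : RigidAdelicSpace K F) :
    (X.tensor Y).minHeight ≤ X.minHeight * Y.minHeight := by
  classical
  obtain hE | hE := subsingleton_or_nontrivial E
  · rw [X.minHeight_of_subsingleton, (X.tensor Y).minHeight_of_subsingleton, zero_mul]
  obtain hF | hF := subsingleton_or_nontrivial F
  · rw [Y.minHeight_of_subsingleton, (X.tensor Y).minHeight_of_subsingleton, mul_zero]
  have hne : (⊤ : Submodule K E) ≠ ⊥ := top_ne_bot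
  have hne' : (⊤ : Submodule K F) ≠ ⊥ := top_ne_bot
  refine Real.le_sInf_mul_sInf ?_ ?_ ?_ ?_ ?_
  · exact ⟨_, ⊤, hne, rfl⟩
  · exact ⟨_, ⊤, hne', rfl⟩
  · rintro _ ⟨V, -, rfl⟩
    exact reducedHeight_nonneg _
  · rintro _ ⟨V, -, rfl⟩
    exact reducedHeight_nonneg _
  rintro _ ⟨V, hV, rfl⟩ _ ⟨V', hV', rfl⟩
  obtain ⟨ι, _, u, 𝔞, hu⟩ := (X.restrict V).exists_isPseudoBasis
  obtain ⟨κ, _, w, 𝔟, hw⟩ := (Y.restrict V').exists_isPseudoBasis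
  have := X.nonempty_of_isPseudoBasis_restrict hV hu
  have := Y.nonempty_of_isPseudoBasis_restrict hV' hw
  have hu' : LinearIndependent K (fun i => (u i : E)) :=
    hu.linearIndependent.map' V.subtype (Submodule.ker_subtype V)
  have hw' : LinearIndependent K (fun i => (w i : F)) :=
    hw.linearIndependent.map' V'.subtype (Submodule.ker_subtype V')
  have h := (X.tensor Y).minHeight_pow_le (hu'.tmul_of_isDomain hw')
    (𝔤 := fun p => 𝔞 p.1 * 𝔟 p.2)
    (fun p => mul_ne_zero (hu.ne_zero _) (hw.ne_zero _))
    (fun p c hc => smul_tmul_mem X Y (fun a ha => hu.smul_mem _ ha) (fun a ha => hw.smul_mem _ ha)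
      hc)
  have hprod : ∏ p : ι × κ, 𝔞 p.1 * 𝔟 p.2 =
      (∏ i, 𝔞 i) ^ Fintype.card κ * (∏ j, 𝔟 j) ^ Fintype.card ι := by
    rw [Fintype.prod_prod_type]
    simp [Finset.prod_mul_distrib, Finset.prod_pow]
  have hgu := X.gramDet_nonneg hu'
  have hgw := Y.gramDet_nonneg hw'
  have e1 := (X.restrict V).reducedHeight_pow_eq hu
  have e2 := (Y.restrict V').reducedHeight_pow_eq hw
  change _ = weightedNorm _ (X.gramDet fun i => (u i : E)) at e1
  change _ = weightedNorm _ (Y.gramDet fun i => (w i : F)) at e2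
  rw [hprod, gramDet_tmul X Y hu' hw', weightedNorm_mul _ _ (pow_nonneg hgu _) (pow_nonneg hgw _),
    weightedNorm_pow _ hgu, weightedNorm_pow _ hgw, ← e1, ← e2, ← pow_mul, ← pow_mul,
    mul_right_comm (finrank ℚ K) (Fintype.card κ), mul_assoc, ← Fintype.card_prod, ← mul_pow] at h
  exact (pow_le_pow_iff_left₀ (minHeight_nonneg _)
    (mul_nonneg (reducedHeight_nonneg _) (reducedHeight_nonneg _))
    (mul_ne_zero finrank_pos.ne' Fintype.card_ne_zero)).mp h

/-- On a generator `x ⊗ y` the contraction is `φ y • x` with `φ y ∈ I`, and `I * I⁻¹ = 1`. It turns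
ideals attached to vectors of `W` into ideals attached to vectors of `E`. -/
theorem smul_contractRight_mem (X : RigidAdelicSpace K E) (Y : RigidAdelicSpace K F) {φ : F →ₗ[K] K}
    {I : FractionalIdeal (𝓞 K)⁰ K} (hI : I ≠ 0) (hφ : ∀ y ∈ Y.lattice, φ y ∈ I) {z : E ⊗[K] F}
    (hz : z ∈ (X.tensor Y).lattice) {c : K} (hc : c ∈ I⁻¹) : c • contractRight φ z ∈ X.lattice := by
  change z ∈ Submodule.span (𝓞 K) _ at hz
  induction hz using Submodule.span_induction with
  | zero => simp
  | add z w _ _ hz hw => rw [map_add, smul_add]; exact add_mem hz hw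
  | smul r z _ hz =>
    rw [← IsScalarTower.algebraMap_smul K r z, map_smul, smul_comm, algebraMap_smul]
    exact X.lattice.smul_mem r hz
  | mem z hz =>
    obtain ⟨x, hx, y, hy, rfl⟩ := hz
    rw [contractRight_tmul, smul_smul, mul_comm]
    exact FractionalIdeal.mul_smul_mem_of_mem_inv hI (hφ y hy) hc hx

/-- The Gram determinant at `v` of vectors `u i ⊗ d` and `x j ⊗ d + w j ⊗ f` of `E ⊗ F`. -/
theorem gramDet_mul_le (X : RigidAdelicSpace K E) (Y : RigidAdelicSpace K F) {d f : F}
    (hdf : LinearIndependent K ![d, f]) {ι κ : Type*} [Fintype ι] [Fintype κ] [DecidableEq ι]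
    [DecidableEq κ] {u : ι → E} {w : κ → E} (hu : LinearIndependent K u)
    (hw : LinearIndependent K w) (x : κ → E) (hli : LinearIndependent K
      (Sum.elim (fun i => u i ⊗ₜ[K] d) (fun j => x j ⊗ₜ[K] d + w j ⊗ₜ[K] f))) :
    Y.gramDet (fun _ : Unit => d) ^ Fintype.card ι * X.gramDet u *
      ((Y.gramDet ![d, f] / Y.gramDet (fun _ : Unit => d)) ^ Fintype.card κ * X.gramDet w) ≤
      (X.tensor Y).gramDet
        (Sum.elim (fun i => u i ⊗ₜ[K] d) (fun j => x j ⊗ₜ[K] d + w j ⊗ₜ[K] f)) := by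
  intro v
  have := X.finiteDimensional
  have hd : LinearIndependent K (fun _ : Unit => d) := by
    simpa using hdf.ne_zero 0
  have hα := Y.gramDet_pos hd v
  have hα' : (Y.form v) d d = (Y.gramDet (fun _ : Unit => d) v : ℂ) := by
    rw [Y.ofReal_gramDet hd, Matrix.det_unique]
    rfl
  have hδ : 0 < Y.gramDet ![d, f] v / Y.gramDet (fun _ : Unit => d) v :=
    div_pos (Y.gramDet_pos hdf v) hα
  have h := (X.form v).det_gram_mul_le (Y.form v) (finBasis K E) (X.posDef v _ _)
    (d := d) (f := f) (Complex.zero_lt_real.mpr hα) (Complex.zero_lt_real.mpr hδ) hα'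
    (Y.conj_symm v d f) (by
      rw [← Complex.ofReal_mul, mul_div_cancel₀ _ hα.ne', Y.ofReal_gramDet hdf,
        Matrix.det_fin_two, ← hα']
      rfl) hu hw x
  rw [← X.ofReal_gramDet hu, ← X.ofReal_gramDet hw] at h
  change _ ≤ (((X.tensor Y).form v).gram _).det at h
  rw [← (X.tensor Y).ofReal_gramDet hli] at h
  exact_mod_cast h

/-- If the lattice of `F` is `𝔞 • d ⊕ 𝔟 • f` and the line `K • d` has at most the height of the
quotient of `F` by it, then `H_min(E) * H_min(F)` bounds the reduced heights of the subspaces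
of `E ⊗ F` from below. -/
theorem minHeight_mul_minHeight_le (X : RigidAdelicSpace K E) (Y : RigidAdelicSpace K F)
    {d f : F} {𝔞 𝔟 : FractionalIdeal (𝓞 K)⁰ K} (hY : IsPseudoBasis Y.lattice ![d, f] ![𝔞, 𝔟])
    (hle : weightedNorm 𝔞 (Y.gramDet fun _ : Unit => d) ≤
      weightedNorm 𝔟 (Y.gramDet ![d, f] / Y.gramDet fun _ : Unit => d))
    {W : Submodule K (E ⊗[K] F)} (hW : W ≠ ⊥) :
    X.minHeight * Y.minHeight ≤ ((X.tensor Y).restrict W).reducedHeight := by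
  classical
  have := X.finiteDimensional
  have h𝔞 : 𝔞 ≠ 0 := hY.ne_zero 0
  have h𝔟 : 𝔟 ≠ 0 := hY.ne_zero 1
  obtain ⟨B, hB⟩ := Y.basis_of_isPseudoBasis hY
  have hB0 : B 0 = d := by simp [hB]
  have hB1 : B 1 = f := by simp [hB]
  have hcoord : ∀ y ∈ Y.lattice, ∀ i, B.coord i y ∈ (![𝔞, 𝔟] : Fin 2 → _) i := by
    intro y hy i
    obtain ⟨a, ha, rfl⟩ := (hY.mem_iff y).mp hy
    rw [← hB, Basis.coord_apply, B.repr_sum_self]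
    exact ha i
  have hsplit : ∀ z : E ⊗[K] F,
      z = contractRight (B.coord 0) z ⊗ₜ[K] d + contractRight (B.coord 1) z ⊗ₜ[K] f := by
    intro z
    rw [← hB0, ← hB1]
    exact TensorProduct.eq_sum_contractRight B z
  set T := (X.tensor Y).restrict W
  have := T.finiteDimensional
  -- The `f`-coordinate identifies `E ⊗ F/D` with `E`. The kernel of `π` is `W ∩ (E ⊗ D)`, with
  -- pseudo-basis `b`, and its image is `V`, with pseudo-basis `w`.
  let π : W →ₗ[K] E := contractRight (B.coord 1) ∘ₗ W.subtype
  obtain ⟨κ, _, w, 𝔢, hw⟩ := Submodule.FG.exists_isPseudoBasis (K := K)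
    (T.lattice.map (π.restrictScalars (𝓞 K))) (T.isLattice.fg.map _)
  obtain ⟨ι, _, b, 𝔠, hb⟩ := Submodule.FG.exists_isPseudoBasis (K := K)
    (T.lattice ⊓ (LinearMap.ker π).restrictScalars (𝓞 K)) (by
      have := isNoetherian_of_fg_of_noetherian _ T.isLattice.fg
      exact T.isLattice.fg.of_le inf_le_left)
  obtain ⟨z, hz, hbz⟩ := hb.exists_extension π hw
  have := (X.tensor Y).nonempty_of_isPseudoBasis_restrict hW hbz
  let u : ι → E := fun i => contractRight (B.coord 0) (b i : E ⊗[K] F)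
  let x : κ → E := fun j => contractRight (B.coord 0) (z j : E ⊗[K] F)
  have hbu : ∀ i, (b i : E ⊗[K] F) = u i ⊗ₜ[K] d := by
    intro i
    have h0 : contractRight (B.coord 1) (b i : E ⊗[K] F) = 0 :=
      hb.mem_of_le (W := LinearMap.ker π) (fun _ hx => hx.2) i
    rw [hsplit (b i), h0, TensorProduct.zero_tmul, add_zero]
  have hzw : ∀ j, (z j : E ⊗[K] F) = x j ⊗ₜ[K] d + w j ⊗ₜ[K] f := by
    intro j
    rw [← hz j]
    exact hsplit (z j)
  have hfam : (fun k => ((Sum.elim b z k : W) : E ⊗[K] F)) =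
      Sum.elim (fun i => u i ⊗ₜ[K] d) (fun j => x j ⊗ₜ[K] d + w j ⊗ₜ[K] f) := by
    funext k
    obtain i | j := k
    exacts [hbu i, hzw j]
  have hli := hbz.linearIndependent.map' W.subtype (Submodule.ker_subtype W)
  change LinearIndependent K (fun k => ((Sum.elim b z k : W) : E ⊗[K] F)) at hli
  rw [hfam] at hli
  have hu : LinearIndependent K u := by
    refine LinearIndependent.of_comp ((TensorProduct.mk K E F).flip d) ?_
    exact hli.comp Sum.inl Sum.inl_injective
  have hd : LinearIndependent K (fun _ : Unit => d) := by
    simpa using hY.linearIndependent.ne_zero 0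
  have hα := Y.gramDet_nonneg hd
  have hδ : 0 ≤ Y.gramDet ![d, f] / Y.gramDet (fun _ : Unit => d) := fun v =>
    div_nonneg (Y.gramDet_nonneg hY.linearIndependent v) (hα v)
  have hαpos := weightedNorm_nonneg 𝔞 hα
  -- `𝔠 i` times `u i ⊗ d` lies in the lattice, and the `d`-coordinate maps the lattice of `F` into
  -- `𝔞`. So `𝔠 i * 𝔞⁻¹` carries `u i` into the lattice of `E`; likewise for `w` with `𝔟` below.
  have hmu := X.minHeight_pow_le hu (𝔤 := fun i => 𝔠 i * 𝔞⁻¹)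
    (fun i => mul_ne_zero (hb.ne_zero i) (inv_ne_zero h𝔞)) (fun i c hc => by
      refine FractionalIdeal.mul_induction_on hc (fun a ha e he => ?_) fun a e ha he => ?_
      · have h := smul_contractRight_mem X Y h𝔞 (fun y hy => hcoord y hy 0) (hb.smul_mem i ha).1 he
        rw [mul_comm, mul_smul]
        change e • contractRight (B.coord 0) (a • (b i : E ⊗[K] F)) ∈ X.lattice at h
        rwa [map_smul] at h
      · rw [add_smul]
        exact add_mem ha he)
  have hmw := X.minHeight_pow_le hw.linearIndependent (𝔤 := fun j => 𝔢 j * 𝔟⁻¹)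
    (fun j => mul_ne_zero (hw.ne_zero j) (inv_ne_zero h𝔟)) (fun j c hc => by
      refine FractionalIdeal.mul_induction_on hc (fun a ha e he => ?_) fun a e ha he => ?_
      · obtain ⟨l, hl, hlw⟩ := hw.smul_mem j ha
        rw [mul_comm, mul_smul, ← hlw]
        exact smul_contractRight_mem X Y h𝔟 (fun y hy => hcoord y hy 1) hl he
      · rw [add_smul]
        exact add_mem ha he)
  have hmd := Y.minHeight_pow_le hd (𝔤 := fun _ => 𝔞) (fun _ => h𝔞)
    (fun _ c hc => hY.smul_mem 0 hc)
  rw [Fintype.card_unit, mul_one, Fintype.prod_unique] at hmd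
  have hgram := gramDet_mul_le X Y hY.linearIndependent hu hw.linearIndependent x hli
  have hheight := T.reducedHeight_pow_eq hbz
  change _ = weightedNorm _
    ((X.tensor Y).gramDet (fun k => ((Sum.elim b z k : W) : E ⊗[K] F))) at hheight
  -- The ideals are regrouped to match `H(D)^p H(U)` and `H(F/D)^q H(V)`.
  have hideal : ∏ k, Sum.elim 𝔠 𝔢 k = 𝔞 ^ Fintype.card ι * (∏ i, 𝔠 i * 𝔞⁻¹) *
      (𝔟 ^ Fintype.card κ * ∏ j, 𝔢 j * 𝔟⁻¹) := by
    rw [Fintype.prod_sum_type, Finset.prod_mul_distrib, Finset.prod_mul_distrib]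
    simp only [Sum.elim_inl, Sum.elim_inr, Finset.prod_const, Finset.card_univ, inv_pow]
    field_simp
  have hgu := X.gramDet_nonneg hu
  have hgw := X.gramDet_nonneg hw.linearIndependent
  have hαι := pow_nonneg hα (Fintype.card ι)
  have hδκ := pow_nonneg hδ (Fintype.card κ)
  refine (pow_le_pow_iff_left₀ (mul_nonneg X.minHeight_nonneg Y.minHeight_nonneg)
    T.reducedHeight_nonneg (mul_ne_zero (finrank_pos (R := ℚ) (M := K)).ne'
      (Fintype.card_ne_zero (α := ι ⊕ κ)))).mp ?_
  have hm := X.minHeight_nonneg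
  rw [hheight, hfam, hideal]
  refine le_trans ?_ (weightedNorm_mono _ (mul_nonneg (mul_nonneg hαι hgu) (mul_nonneg hδκ hgw))
    hgram)
  rw [weightedNorm_mul _ _ (mul_nonneg hαι hgu) (mul_nonneg hδκ hgw),
    weightedNorm_mul _ _ hαι hgu, weightedNorm_mul _ _ hδκ hgw, weightedNorm_pow _ hα,
    weightedNorm_pow _ hδ]
  have hsum : (X.minHeight * Y.minHeight) ^ (finrank ℚ K * Fintype.card (ι ⊕ κ)) =
      (Y.minHeight ^ finrank ℚ K) ^ Fintype.card ι *
        X.minHeight ^ (finrank ℚ K * Fintype.card ι) *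
      ((Y.minHeight ^ finrank ℚ K) ^ Fintype.card κ *
        X.minHeight ^ (finrank ℚ K * Fintype.card κ)) := by
    rw [Fintype.card_sum, mul_add, pow_add, mul_pow, mul_pow, ← pow_mul, ← pow_mul]
    ring
  rw [hsum]
  have hm' := Y.minHeight_nonneg
  -- The hypothesis on `D` enters here: the `q` factors coming from `F/D` are also bounded below by
  -- `H_min(F)`.
  have hmd' := hmd.trans hle
  have hgu' := weightedNorm_nonneg (∏ i, 𝔠 i * 𝔞⁻¹) hgu
  have hδ' := pow_nonneg (weightedNorm_nonneg 𝔟 hδ) (Fintype.card κ)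
  have hgw' := weightedNorm_nonneg (∏ j, 𝔢 j * 𝔟⁻¹) hgw
  gcongr

/-- The lattice of a rigid adelic space of rank two has a pseudo-basis adapted to a line. -/
theorem exists_isPseudoBasis_of_line (Y : RigidAdelicSpace K F) (hF : finrank K F = 2)
    {D : Submodule K F} (hD : finrank K D = 1) :
    ∃ (d f : F) (𝔞 𝔟 : FractionalIdeal (𝓞 K)⁰ K),
      IsPseudoBasis Y.lattice ![d, f] ![𝔞, 𝔟] ∧
      (Y.restrict D).reducedHeight ^ finrank ℚ K =
        weightedNorm 𝔞 (Y.gramDet fun _ : Unit => d) := by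
  classical
  have := Y.finiteDimensional
  obtain ⟨ι, _, u, 𝔠, hu⟩ := (Y.restrict D).exists_isPseudoBasis
  obtain ⟨eι⟩ : Nonempty (Unit ≃ ι) := by
    rw [← Fintype.card_eq, (Y.restrict D).card_eq_finrank hu, hD, Fintype.card_unit]
  have hu' := hu.reindex eι
  -- The adapted pseudo-basis comes from `0 → D → F → F/D → 0`, both ends having rank one.
  have hker : IsPseudoBasis (Y.lattice ⊓ (LinearMap.ker D.mkQ).restrictScalars (𝓞 K))
      (fun i => ((u ∘ eι) i : F)) (𝔠 ∘ eι) := by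
    rw [Submodule.ker_mkQ]
    exact hu'.of_comap_subtype
  obtain ⟨κ, _, w, 𝔢, hw⟩ := Submodule.FG.exists_isPseudoBasis (K := K)
    (Y.lattice.map (D.mkQ.restrictScalars (𝓞 K))) (Y.isLattice.fg.map _)
  obtain ⟨z, -, hz⟩ := hker.exists_extension D.mkQ hw
  obtain ⟨eκ⟩ : Nonempty (Unit ≃ κ) := by
    have := Y.card_eq_finrank hz
    rw [Fintype.card_sum, hF, Fintype.card_unit] at this
    rw [← Fintype.card_eq, Fintype.card_unit]
    omega
  let e : Fin 2 ≃ Unit ⊕ κ :=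
    { toFun := ![Sum.inl (), Sum.inr (eκ ())]
      invFun := Sum.elim (fun _ => 0) (fun _ => 1)
      left_inv := fun i => by fin_cases i <;> rfl
      right_inv := by
        rintro (i | j)
        · rfl
        · obtain ⟨⟨⟩, rfl⟩ := eκ.surjective j
          rfl }
  refine ⟨u (eι ()), z (eκ ()), 𝔠 (eι ()), 𝔢 (eκ ()), ?_, ?_⟩
  · convert hz.reindex e using 1
    · funext i
      fin_cases i <;> rfl
    · funext i
      fin_cases i <;> rfl
  · have h := (Y.restrict D).reducedHeight_pow_eq hu'
    rwa [Fintype.card_unit, mul_one, Fintype.prod_unique] at h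

end RigidAdelicSpace

end

/-! ### The corollary. -/

theorem corollary2p6 {K : Type*} [Field K] [NumberField K]
    {F : Type*} [AddCommGroup F] [Module K F] [Module (𝓞 K) F] [IsScalarTower (𝓞 K) K F]
    (Y : RigidAdelicSpace K F) (hrank : Module.finrank K F = 2) (hstable : ¬ Y.IsStable)
    {E : Type*} [AddCommGroup E] [Module K E] [Module (𝓞 K) E] [IsScalarTower (𝓞 K) K E]
    (X : RigidAdelicSpace K E) :
    (X.tensor Y).minHeight = X.minHeight * Y.minHeight := by
  have := Y.finiteDimensional
  refine le_antisymm (X.minHeight_tensor_le Y) ?_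
  obtain hE | hE := subsingleton_or_nontrivial E
  · rw [X.minHeight_of_subsingleton, (X.tensor Y).minHeight_of_subsingleton, zero_mul]
  have hF : Nontrivial F := nontrivial_of_finrank_pos (R := K) (by omega)
  obtain ⟨D, hD0, hD1, hD⟩ : ∃ D : Submodule K F, D ≠ ⊥ ∧ D ≠ ⊤ ∧
      (Y.restrict D).reducedHeight ≤ Y.reducedHeight := by
    simpa [RigidAdelicSpace.IsStable] using hstable
  have hrankD : finrank K D = 1 := by
    have h1 := Submodule.finrank_lt hD1
    have h2 := Submodule.one_le_finrank_iff.mpr hD0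
    omega
  obtain ⟨d, f, 𝔞, 𝔟, hY, hd⟩ := Y.exists_isPseudoBasis_of_line hrank hrankD
  have hdli : LinearIndependent K (fun _ : Unit => d) := by
    simpa using hY.linearIndependent.ne_zero 0
  have hα := Y.gramDet_pos hdli
  -- In `H(D)^2 ≤ H_r(F)^2 = H(D) H(F/D)`, raised to the power `[K : ℚ]`, the positive factor
  -- belonging to `D` is cancelled.
  have hle : RigidAdelicSpace.weightedNorm 𝔞 (Y.gramDet fun _ : Unit => d) ≤
      RigidAdelicSpace.weightedNorm 𝔟 (Y.gramDet ![d, f] / Y.gramDet fun _ : Unit => d) := by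
    have h1 := Y.reducedHeight_pow_eq hY
    have h2 : Y.gramDet ![d, f] = (Y.gramDet fun _ : Unit => d) *
        (Y.gramDet ![d, f] / Y.gramDet fun _ : Unit => d) :=
      funext fun v => (mul_div_cancel₀ _ (hα v).ne').symm
    have h3 : ∏ i, (![𝔞, 𝔟] : Fin 2 → _) i = 𝔞 * 𝔟 := by simp
    have h4 : 0 ≤ Y.gramDet ![d, f] / Y.gramDet fun _ : Unit => d := fun v =>
      div_nonneg (Y.gramDet_nonneg hY.linearIndependent v) (hα v).le
    rw [h2, h3, RigidAdelicSpace.weightedNorm_mul _ _ (fun v => (hα v).le) h4, Fintype.card_fin] at h1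
    refine le_of_mul_le_mul_left ?_ (RigidAdelicSpace.weightedNorm_pos (hY.ne_zero 0) hα)
    change RigidAdelicSpace.weightedNorm 𝔞 _ * _ ≤ RigidAdelicSpace.weightedNorm 𝔞 _ * _
    rw [← h1, ← hd, ← pow_two, ← pow_mul]
    exact pow_le_pow_left₀ (RigidAdelicSpace.reducedHeight_nonneg _) hD _
  refine le_csInf ⟨_, ⊤, top_ne_bot, rfl⟩ ?_
  rintro _ ⟨W, hW, rfl⟩
  exact RigidAdelicSpace.minHeight_mul_minHeight_le X Y hY hle hW
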